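/- **The geometric Lorenz model.** Let $\lambda_1,\lambda_2,\lambda_3,\theta$ be real parameters with $0<\lambda_3<\lambda_1<\lambda_2$, put $\alpha=\lambda_3/\lambda_1$, $\beta=\lambda_2/\lambda_1$, and suppose that $\frac1{\sqrt2}<\alpha<1$, $\beta>\frac{\log 6}{\log 2}-1$ and $\frac{2^\alpha}{\sqrt2\,\alpha}<\theta<2^\alpha$. Let $S=\{(u_1,u_2,1):|u_1|\le\frac12,|u_2|\le\frac12\}$. A path started at $u\in S$ first follows the linear flow $\Psi^{\mathrm{lin}}_t(u)=(u_1e^{\lambda_1t},u_2e^{-\lambda_2t},u_3e^{-\lambda_3t})$; if $u_1=0$ it does so for all $t\ge0$; otherwise it does so until the time $\frac1{\lambda_1}\log\frac1{|u_1|}$, at which it is at the point $y=(\mathrm{sgn}(u_1),\,u_2|u_1|^\beta,\,|u_1|^\alpha)$. From $y$ it moves, for $0\le s\le\frac32\pi$, along $$\Big(\pm\big(1+r(s)\sin s\big),\; y_2\mp\tfrac14\cdot\tfrac{s}{(3/2)\pi},\; 1-r(s)\cos s\Big),\qquad r(s)=1-y_3+\big(\tfrac12-(\theta-1)y_3\big)\tfrac{s}{(3/2)\pi},$$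 with the upper signs if $y_1=1$ and the lower signs if $y_1=-1$; at $s=\frac32\pi$ it is back in $S$, and the motion is continued in the same way from there. Let $\Lambda\subset\mathbb R^3$ be the union of the points of all paths started from $S$ until their first return to $S$ (for all times if $u_1=0$). Different such paths do not meet before their first return, so this defines a semigroup $\Psi_t:\Lambda\to\Lambda$, $t\ge0$. **Observations and smoother.** Let $q$ be a probability density on $\mathbb R^3$ that vanishes outside $\Lambda$ (the prior). Let $h,\varepsilon>0$ and $u\in\Lambda$, let $Z_0,Z_1,\dots$ be i.i.d. random vectors uniformly distributed on $[-\varepsilon,\varepsilon]^3$, and let $Y_i=\Psi_{ih}(u)+Z_i$ be the observations (the observation matrix is the identity). With $\eta=(2\varepsilon)^{-3}\mathbf 1_{[-\varepsilon,\varepsilon]^3}$, the smoothing density given $Y_0,\dots,Y_k$ is $$\mu_k(v)=\frac1{\mathcal Z_k}\,q(v)\prod_{i=0}^k\eta\big(Y_i-\Psi_{ih}(v)\big)\ \ (v\in\Lambda),\qquad \mu_k(v)=0\ \ (v\notin\Lambda),$$ where $\mathcal Z_k$ is the normalising constant. Its support is $S_k=\{v:\mu_k(v)\neq0\}$ (with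 $S_k=\emptyset$ if $\mathcal Z_k=0$, and a supremum over the empty set being $0$). **Theorem.** There are constants $h_{\max}>0$ and $\varepsilon_{\max}>0$, depending only on the parameters of the model, such that for every prior $q$ as above, all $0<\varepsilon\le\varepsilon_{\max}$ and $0<h\le h_{\max}$, and Lebesgue-almost every $u\in\Lambda$, $$\sup_{v\in S_k}d\big(v,U(u,\varepsilon)\big)\to0\quad\text{as }k\to\infty,\ \text{almost surely in the observations},$$ where $U(u,\varepsilon)=\{v\in\mathbb R^3: v_1=u_1,\ v_3=u_3,\ |v_2-u_2|<2\varepsilon\}$ and $d(v,U(u,\varepsilon))=\inf_{w\in U(u,\varepsilon)}\|v-w\|$ with the Euclidean norm. -/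

import Mathlib

open MeasureTheory ProbabilityTheory Filter Topology

noncomputable section

namespace GeoLorenz

/-- Three-dimensional Euclidean space; the coordinates `u₁, u₂, u₃` are `u 0, u 1, u 2`. -/
abbrev E3 : Type := EuclideanSpace ℝ (Fin 3)

/-- The parameters of the geometric Lorenz model: the eigenvalues `λ₁, -λ₂, -λ₃` of the linear part
and the expansion factor `θ` of the rotation part. -/
structure Params where
  lam1 : ℝ
  lam2 : ℝ
  lam3 : ℝ
  theta : ℝ

namespace Params

variable (p : Params)

def alpha : ℝ := p.lam3 / p.lam1

def beta : ℝ := p.lam2 / p.lam1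

/-- The standing conditions on the parameters. -/
structure Admissible : Prop where
  lam3_pos : 0 < p.lam3
  lam3_lt_lam1 : p.lam3 < p.lam1
  lam1_lt_lam2 : p.lam1 < p.lam2
  alpha_gt : 1 / √2 < p.alpha
  alpha_lt : p.alpha < 1
  beta_gt : Real.log 6 / Real.log 2 - 1 < p.beta
  theta_gt : (2 : ℝ) ^ p.alpha / (√2 * p.alpha) < p.theta
  theta_lt : p.theta < (2 : ℝ) ^ p.alpha

/-- The linear flow `Ψ^lin`. -/
def linFlow (t : ℝ) (u : E3) : E3 :=
  !₂[u 0 * Real.exp (p.lam1 * t), u 1 * Real.exp (-p.lam2 * t), u 2 * Real.exp (-p.lam3 * t)]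

/-- The time that the linear flow needs from a point `u` of the return square with `u₁ ≠ 0`
to the set `Σ = {|u₁| = 1}`. -/
def timeToSigma (u : E3) : ℝ := 1 / p.lam1 * Real.log (1 / |u 0|)

/-- The point of `Σ` reached from `u`. -/
def exitPoint (u : E3) : E3 := p.linFlow (p.timeToSigma u) u

/-- The radius `r(s)` in the rotation part, for the path that starts at `y ∈ Σ`. -/
def rotRadius (y : E3) (s : ℝ) : ℝ :=
  1 - y 2 + (1 / 2 - (p.theta - 1) * y 2) * (s / (3 / 2 * Real.pi))

/-- The flow `Ψ^rot` from `Σ` back to the return square, for `0 ≤ s ≤ 3π/2`; the first case is the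
cusp `Σ⁺` in `{u₁ = 1}`, the second one is the cusp `Σ⁻` in `{u₁ = -1}`. -/
def rotFlow (s : ℝ) (y : E3) : E3 :=
  if 0 < y 0 then
    !₂[1 + p.rotRadius y s * Real.sin s, y 1 - 1 / 4 * (s / (3 / 2 * Real.pi)),
      1 - p.rotRadius y s * Real.cos s]
  else
    !₂[-1 - p.rotRadius y s * Real.sin s, y 1 + 1 / 4 * (s / (3 / 2 * Real.pi)),
      1 - p.rotRadius y s * Real.cos s]

/-- The return square `S`. -/
def returnSquare : Set E3 := {u | |u 0| ≤ 1 / 2 ∧ |u 1| ≤ 1 / 2 ∧ u 2 = 1}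

/-- The return time of a point `u ∈ S` with `u₁ ≠ 0`. -/
def returnTime (u : E3) : ℝ := p.timeToSigma u + 3 / 2 * Real.pi

/-- The return map, on the points `u ∈ S` with `u₁ ≠ 0`. -/
def returnMap (u : E3) : E3 := p.rotFlow (3 / 2 * Real.pi) (p.exitPoint u)

/-- The path started at `u ∈ S`, at time `t ≥ 0`, until the first return to `S`. If `u₁ = 0`, the
path follows the linear flow for ever and never returns. -/
def excursion (u : E3) (t : ℝ) : E3 :=
  if u 0 = 0 ∨ t ≤ p.timeToSigma u then p.linFlow t u
  else p.rotFlow (t - p.timeToSigma u) (p.exitPoint u)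

/-- The time `t ≥ 0` is before the first return to `S` of the path started at `u ∈ S`. -/
def BeforeReturn (u : E3) (t : ℝ) : Prop := 0 ≤ t ∧ (u 0 ≠ 0 → t < p.returnTime u)

/-- The path started at `x.1 ∈ S` is at `v` at the time `x.2`, before its first return to `S`. -/
def IsOrigin (v : E3) (x : E3 × ℝ) : Prop :=
  x.1 ∈ returnSquare ∧ p.BeforeReturn x.1 x.2 ∧ p.excursion x.1 x.2 = v

/-- The state space: all points on the paths started from `S`, until their first return to `S`.
The end points of these paths lie on `S`, hence are themselves initial points of paths. -/
def stateSpace : Set E3 := {v | ∃ x, p.IsOrigin v x}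

/-- The origin of `v` on `S`, together with the time needed from there to `v`. For admissible
parameters and `v` in the state space this pair is unique, see `IsOrigin.unique`. -/
def origin (v : E3) : E3 × ℝ := Classical.epsilon (p.IsOrigin v)

/-- The path started at `u ∈ S`, at time `t ≥ 0`, where at most `n` returns are carried out. -/
def orbitAux : ℕ → E3 → ℝ → E3
  | 0, u, t => p.excursion u t
  | n + 1, u, t =>
    if u 0 = 0 ∨ t < p.returnTime u then p.excursion u t
    else orbitAux n (p.returnMap u) (t - p.returnTime u)

/-- The path started at `u ∈ S`, at time `t ≥ 0`. Every return takes more than one unit of time,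
so that there are at most `⌊t⌋` returns up to time `t`. -/
def orbit (u : E3) (t : ℝ) : E3 := p.orbitAux ⌊t⌋₊ u t

/-- The semigroup `Ψ^geo` of the geometric model on its state space, for `t ≥ 0`. -/
def flow (t : ℝ) (v : E3) : E3 := p.orbit (p.origin v).1 ((p.origin v).2 + t)

end Params

/-- The cube `[-ε, ε]³`. -/
def noiseCube (ε : ℝ) : Set E3 := {z | ∀ j, z j ∈ Set.Icc (-ε) ε}

/-- The density of the uniform distribution on `[-ε, ε]³`. -/
def noiseDensity (ε : ℝ) : E3 → ℝ := (noiseCube ε).indicator fun _ => ((2 * ε) ^ 3)⁻¹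

namespace Params

variable (p : Params)

/-- A prior density on the state space. -/
structure IsPrior (q : E3 → ℝ) : Prop where
  measurable : Measurable q
  nonneg : ∀ v, 0 ≤ q v
  zero_outside : ∀ v, v ∉ p.stateSpace → q v = 0
  integrable : Integrable q volume
  integral_eq_one : ∫ v, q v = 1

/-- The product of the likelihood of the initial point `v`, given the observations `Y 0, …, Y k` at
the times `0, h, …, k h` of the whole state (the observation matrix is the identity) with
uniform noise on `[-ε, ε]³`, and of the prior density. -/
def smootherWeight (h ε : ℝ) (q : E3 → ℝ) (k : ℕ) (Y : ℕ → E3) (v : E3) : ℝ :=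
  (∏ i ∈ Finset.range (k + 1), noiseDensity ε (Y i - p.flow (i * h) v)) * q v

/-- The density of the smoothing distribution. -/
def smootherDensity (h ε : ℝ) (q : E3 → ℝ) (k : ℕ) (Y : ℕ → E3) : E3 → ℝ :=
  p.stateSpace.indicator fun v =>
    p.smootherWeight h ε q k Y v / ∫ w in p.stateSpace, p.smootherWeight h ε q k Y w

/-- The support of the smoother: the points where its density is non-zero. -/
def smootherSupport (h ε : ℝ) (q : E3 → ℝ) (k : ℕ) (Y : ℕ → E3) : Set E3 :=
  Function.support (p.smootherDensity h ε q k Y)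

end Params

/-- The `2ε`-cropped leaf set of `u`. -/
def leafSegment (u : E3) (ε : ℝ) : Set E3 :=
  {v | v 0 = u 0 ∧ v 2 = u 2 ∧ |v 1 - u 1| < 2 * ε}

namespace Params

variable {p : Params}

theorem Admissible.lam1_pos (hp : p.Admissible) : 0 < p.lam1 := hp.lam3_pos.trans hp.lam3_lt_lam1

theorem Admissible.theta_pos (hp : p.Admissible) : 0 < p.theta := by
  have h1 : 0 < p.alpha := div_pos hp.lam3_pos hp.lam1_pos
  refine lt_trans ?_ hp.theta_gt
  positivity

theorem log_two_le_timeToSigma (hp : p.Admissible) {u : E3} (hu : u ∈ returnSquare)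
    (h0 : u 0 ≠ 0) : Real.log 2 / p.lam1 ≤ p.timeToSigma u := by
  have h1 := hp.lam1_pos
  have h2 : 0 < |u 0| := abs_pos.2 h0
  have h3 : (2 : ℝ) ≤ 1 / |u 0| := by
    rw [le_div_iff₀ h2]
    linarith [hu.1]
  have h4 := Real.log_le_log (by norm_num) h3
  unfold timeToSigma
  rw [one_div_mul_eq_div]
  gcongr

theorem exp_timeToSigma (hp : p.Admissible) {u : E3} (h0 : u 0 ≠ 0) :
    Real.exp (p.lam1 * p.timeToSigma u) = 1 / |u 0| := by
  have h1 := hp.lam1_pos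
  have h2 : 0 < |u 0| := abs_pos.2 h0
  have h3 : p.lam1 * p.timeToSigma u = Real.log (1 / |u 0|) := by
    unfold timeToSigma
    field_simp
  rw [h3, Real.exp_log (by positivity)]

/-- The exit points lie on the cusps of `Σ`. -/
theorem exitPoint_bounds (hp : p.Admissible) {u : E3} (hu : u ∈ returnSquare) (h0 : u 0 ≠ 0) :
    p.exitPoint u 0 = u 0 / |u 0| ∧ |p.exitPoint u 1| < 1 / 6 ∧
      p.exitPoint u 2 = Real.exp (-p.lam3 * p.timeToSigma u) ∧ 0 < p.exitPoint u 2 ∧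
      p.exitPoint u 2 < 1 ∧ p.theta * p.exitPoint u 2 < 1 := by
  have h1 := hp.lam1_pos
  have h3 := hp.lam3_pos
  have hT := log_two_le_timeToSigma hp hu h0
  have hT0 : 0 < p.timeToSigma u := lt_of_lt_of_le (div_pos (Real.log_pos (by norm_num)) h1) hT
  have e2 : p.exitPoint u 2 = Real.exp (-p.lam3 * p.timeToSigma u) := by
    simp [exitPoint, linFlow, hu.2.2]
  have e1 : p.exitPoint u 1 = u 1 * Real.exp (-p.lam2 * p.timeToSigma u) := by
    simp [exitPoint, linFlow]
  have l2 : 0 < p.lam2 := h1.trans hp.lam1_lt_lam2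
  have hlog : (0 : ℝ) < Real.log 2 := Real.log_pos (by norm_num)
  refine ⟨?_, ?_, e2, ?_, ?_, ?_⟩
  · have := exp_timeToSigma hp h0
    simp only [exitPoint, linFlow, PiLp.toLp_apply, Matrix.cons_val_zero, this]
    ring
  · rw [e1, abs_mul, abs_of_pos (Real.exp_pos _)]
    have a1 : p.beta * Real.log 2 ≤ p.lam2 * p.timeToSigma u := by
      have : p.beta * Real.log 2 = p.lam2 * (Real.log 2 / p.lam1) := by
        unfold beta
        ring
      rw [this]
      gcongr
    have a2 : Real.log 6 - Real.log 2 < p.beta * Real.log 2 := by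
      have := mul_lt_mul_of_pos_right hp.beta_gt hlog
      rwa [sub_mul, div_mul_cancel₀ _ hlog.ne', one_mul] at this
    have a3 : Real.exp (-p.lam2 * p.timeToSigma u) < 1 / 3 := by
      have : (1 : ℝ) / 3 = Real.exp (-(Real.log 6 - Real.log 2)) := by
        rw [neg_sub, Real.exp_sub, Real.exp_log (by norm_num), Real.exp_log (by norm_num)]
        norm_num
      rw [this]
      apply Real.exp_lt_exp.2
      linarith
    have := Real.exp_pos (-p.lam2 * p.timeToSigma u)
    nlinarith [hu.2.1, abs_nonneg (u 1)]
  · rw [e2]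
    exact Real.exp_pos _
  · rw [e2, Real.exp_lt_one_iff]
    nlinarith
  · have b1 : Real.exp (-p.lam3 * p.timeToSigma u) ≤ ((2 : ℝ) ^ p.alpha)⁻¹ := by
      rw [Real.rpow_def_of_pos (by norm_num), ← Real.exp_neg]
      apply Real.exp_le_exp.2
      have : Real.log 2 * p.alpha = p.lam3 * (Real.log 2 / p.lam1) := by
        unfold alpha
        ring
      rw [this, neg_mul]
      gcongr
    have b2 : (0 : ℝ) < (2 : ℝ) ^ p.alpha := by positivity
    rw [e2]
    calc p.theta * Real.exp (-p.lam3 * p.timeToSigma u)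
        ≤ p.theta * ((2 : ℝ) ^ p.alpha)⁻¹ := mul_le_mul_of_nonneg_left b1 hp.theta_pos.le
      _ < (2 : ℝ) ^ p.alpha * ((2 : ℝ) ^ p.alpha)⁻¹ :=
        mul_lt_mul_of_pos_right hp.theta_lt (by positivity)
      _ = 1 := mul_inv_cancel₀ b2.ne'

/-- The paths return to `S`. -/
theorem returnMap_mem (hp : p.Admissible) {u : E3} (hu : u ∈ returnSquare) (h0 : u 0 ≠ 0) :
    p.returnMap u ∈ returnSquare := by
  obtain ⟨-, e1, -, e3, e4, e5⟩ := exitPoint_bounds hp hu h0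
  have hs : Real.sin (3 / 2 * Real.pi) = -1 := by
    rw [show 3 / 2 * Real.pi = Real.pi / 2 + Real.pi by ring, Real.sin_add_pi, Real.sin_pi_div_two]
  have hc : Real.cos (3 / 2 * Real.pi) = 0 := by
    rw [show 3 / 2 * Real.pi = Real.pi / 2 + Real.pi by ring, Real.cos_add_pi, Real.cos_pi_div_two,
      neg_zero]
  have hd : 3 / 2 * Real.pi / (3 / 2 * Real.pi) = 1 := div_self (by positivity)
  have := mul_pos hp.theta_pos e3
  rw [abs_lt] at e1
  unfold returnMap rotFlow rotRadius returnSquare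
  split_ifs <;> refine ⟨?_, ?_, ?_⟩ <;>
    simp only [Matrix.cons_val_zero, Matrix.cons_val_one, Matrix.cons_val, hs, hc, hd, abs_le] <;> first | constructor <;> linarith | linarith

/-- A point of the state space lies either on the linear part or inside the rotation part. -/
theorem IsOrigin.cases (hp : p.Admissible) {v : E3} {x : E3 × ℝ} (hx : p.IsOrigin v x) :
    (v = p.linFlow x.2 x.1 ∧ |v 0| ≤ 1 ∧ v 2 ≤ 1) ∨
    (x.1 0 ≠ 0 ∧ (1 < |v 0| ∨ 1 < v 2) ∧ ∃ s r : ℝ, 0 < s ∧ s < 3 / 2 * Real.pi ∧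
      x.2 = p.timeToSigma x.1 + s ∧ r = p.rotRadius (p.exitPoint x.1) s ∧ 0 < r ∧ r < 3 / 2 ∧
      v 2 = 1 - r * Real.cos s ∧
      ((0 < x.1 0 ∧ v 0 = 1 + r * Real.sin s ∧
          v 1 = p.exitPoint x.1 1 - 1 / 4 * (s / (3 / 2 * Real.pi))) ∨
        (x.1 0 < 0 ∧ v 0 = -1 - r * Real.sin s ∧
          v 1 = p.exitPoint x.1 1 + 1 / 4 * (s / (3 / 2 * Real.pi))))) := by
  obtain ⟨u, t⟩ := x
  obtain ⟨hu, ⟨ht, htr⟩, hv⟩ := hx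
  simp only at hu ht htr hv ⊢
  have h1 := hp.lam1_pos
  by_cases hc : u 0 = 0 ∨ t ≤ p.timeToSigma u
  · left
    rw [excursion, if_pos hc] at hv
    refine ⟨hv.symm, ?_, ?_⟩
    · rw [← hv]
      simp only [linFlow, PiLp.toLp_apply, Matrix.cons_val_zero]
      rcases eq_or_ne (u 0) 0 with h0 | h0
      · simp [h0]
      · have hle : t ≤ p.timeToSigma u := hc.resolve_left h0
        rw [abs_mul, abs_of_pos (Real.exp_pos _)]
        calc |u 0| * Real.exp (p.lam1 * t) ≤ |u 0| * Real.exp (p.lam1 * p.timeToSigma u) := by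
              gcongr
          _ = 1 := by
              rw [exp_timeToSigma hp h0]
              field_simp
    · rw [← hv]
      simp only [linFlow, PiLp.toLp_apply, Matrix.cons_val, hu.2.2, one_mul]
      rw [Real.exp_le_one_iff]
      nlinarith [hp.lam3_pos]
  · right
    rw [excursion, if_neg hc] at hv
    push Not at hc
    obtain ⟨h0, hlt⟩ := hc
    have htr := htr h0
    unfold returnTime at htr
    obtain ⟨e0, -, -, e3, e4, e5⟩ := exitPoint_bounds hp hu h0
    set s := t - p.timeToSigma u with hs
    have hs0 : 0 < s := by linarith
    have hs1 : s < 3 / 2 * Real.pi := by linarith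
    have hpi := Real.pi_pos
    have hc0 : 0 < s / (3 / 2 * Real.pi) := by positivity
    have hc1 : s / (3 / 2 * Real.pi) < 1 := by
      rw [div_lt_one (by positivity)]
      exact hs1
    have hr : p.rotRadius (p.exitPoint u) s = (1 - s / (3 / 2 * Real.pi)) * (1 - p.exitPoint u 2) +
        s / (3 / 2 * Real.pi) * (3 / 2 - p.theta * p.exitPoint u 2) := by
      unfold rotRadius
      ring
    have hr0 : 0 < p.rotRadius (p.exitPoint u) s := by
      rw [hr]
      have := mul_pos (sub_pos.2 hc1) (sub_pos.2 e4)
      have : 0 < s / (3 / 2 * Real.pi) * (3 / 2 - p.theta * p.exitPoint u 2) :=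
        mul_pos hc0 (by linarith)
      linarith
    have hr1 : p.rotRadius (p.exitPoint u) s < 3 / 2 := by
      rw [hr]
      have := mul_pos hp.theta_pos e3
      nlinarith
    set r := p.rotRadius (p.exitPoint u) s
    have hv2 : v 2 = 1 - r * Real.cos s := by
      rw [← hv]
      unfold rotFlow
      split_ifs <;> simp [r]
    have hsg : (0 < u 0 ∧ v 0 = 1 + r * Real.sin s ∧
          v 1 = p.exitPoint u 1 - 1 / 4 * (s / (3 / 2 * Real.pi))) ∨
        (u 0 < 0 ∧ v 0 = -1 - r * Real.sin s ∧
          v 1 = p.exitPoint u 1 + 1 / 4 * (s / (3 / 2 * Real.pi))) := by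
      rcases lt_or_gt_of_ne h0 with hn | hn
      · right
        have : ¬ 0 < p.exitPoint u 0 := by
          rw [e0, not_lt]
          exact div_nonpos_of_nonpos_of_nonneg hn.le (abs_nonneg _)
        rw [rotFlow, if_neg this] at hv
        refine ⟨hn, ?_, ?_⟩ <;> rw [← hv] <;> simp [r]
      · left
        have : 0 < p.exitPoint u 0 := by
          rw [e0]
          positivity
        rw [rotFlow, if_pos this] at hv
        refine ⟨hn, ?_, ?_⟩ <;> rw [← hv] <;> simp [r]
    refine ⟨h0, ?_, s, r, hs0, hs1, by rw [hs]; ring, rfl, hr0, hr1, hv2, hsg⟩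
    rcases lt_or_ge s Real.pi with hsp | hsp
    · left
      have := mul_pos hr0 (Real.sin_pos_of_pos_of_lt_pi hs0 hsp)
      rcases hsg with ⟨-, h, -⟩ | ⟨-, h, -⟩
      · rw [h, lt_abs]
        left
        linarith
      · rw [h, lt_abs]
        right
        linarith
    · right
      have : Real.cos s < 0 :=
        Real.cos_neg_of_pi_div_two_lt_of_lt (by linarith) (by linarith)
      rw [hv2]
      nlinarith

/-- The origin of a point of the state space is unique: paths started at different points of `S` do
not meet before their first return. -/
theorem IsOrigin.unique (hp : p.Admissible) {v : E3} {x y : E3 × ℝ} (hx : p.IsOrigin v x)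
    (hy : p.IsOrigin v y) : x = y := by
  have hxc := hx.cases hp
  have hyc := hy.cases hp
  obtain ⟨u, t⟩ := x
  obtain ⟨w, t'⟩ := y
  obtain ⟨hu, -, -⟩ := hx
  obtain ⟨hw, -, -⟩ := hy
  simp only at hu hw hxc hyc
  have l1 := hp.lam1_pos
  have l3 := hp.lam3_pos
  have key : u 0 = w 0 → u 1 = w 1 → t = t' → (u, t) = (w, t') := by
    intro h0 h1 h2
    have : u = w := by
      ext j
      fin_cases j
      · exact h0
      · exact h1
      · exact hu.2.2.trans hw.2.2.symm
    rw [this, h2]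
  rcases hxc with ⟨a, a0, a2⟩ | ⟨au, a02, s, r, s0, s1, ht, hr, r0, r1, v2, hs⟩ <;>
    rcases hyc with ⟨b, b0, b2⟩ | ⟨bw, b02, s', r', s0', s1', ht', hr', r0', r1', v2', hs'⟩
  · have e2 : v 2 = Real.exp (-p.lam3 * t) := by rw [a]; simp [linFlow, hu.2.2]
    have f2 : v 2 = Real.exp (-p.lam3 * t') := by rw [b]; simp [linFlow, hw.2.2]
    have htt : t = t' := by
      have := Real.exp_injective (e2.symm.trans f2)
      exact mul_left_cancel₀ (neg_ne_zero.2 l3.ne') this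
    subst htt
    have e0 : v 0 = u 0 * Real.exp (p.lam1 * t) := by rw [a]; simp [linFlow]
    have f0 : v 0 = w 0 * Real.exp (p.lam1 * t) := by rw [b]; simp [linFlow]
    have e1 : v 1 = u 1 * Real.exp (-p.lam2 * t) := by rw [a]; simp [linFlow]
    have f1 : v 1 = w 1 * Real.exp (-p.lam2 * t) := by rw [b]; simp [linFlow]
    exact key (mul_right_cancel₀ (Real.exp_pos _).ne' (e0.symm.trans f0))
      (mul_right_cancel₀ (Real.exp_pos _).ne' (e1.symm.trans f1)) rfl
  · rcases b02 with h | h <;> linarith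
  · rcases a02 with h | h <;> linarith
  · have hpi := Real.pi_pos
    obtain ⟨-, c1, c2, -, -, -⟩ := exitPoint_bounds hp hu au
    obtain ⟨-, d1, d2, -, -, -⟩ := exitPoint_bounds hp hw bw
    rw [abs_lt] at c1 d1
    have cross : ∀ (s r s' r' y y' : ℝ), 0 < s → s < 3 / 2 * Real.pi → 0 < s' →
        s' < 3 / 2 * Real.pi → 0 < r → r < 3 / 2 → 0 < r' → r' < 3 / 2 → y < 1 / 6 → -(1 / 6) < y' →
        v 0 = 1 + r * Real.sin s → v 0 = -1 - r' * Real.sin s' →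
        v 1 = y - 1 / 4 * (s / (3 / 2 * Real.pi)) →
        v 1 = y' + 1 / 4 * (s' / (3 / 2 * Real.pi)) → False := by
      intro s r s' r' y y' h1 h2 h3 h4 h5 h6 h7 h8 h9 h10 h11 h12 h13 h14
      rcases le_or_gt s Real.pi with hsp | hsp
      · have := mul_nonneg h5.le (Real.sin_nonneg_of_nonneg_of_le_pi h1.le hsp)
        have := Real.neg_one_le_sin s'
        nlinarith
      · rcases le_or_gt s' Real.pi with hsp' | hsp'
        · have := mul_nonneg h7.le (Real.sin_nonneg_of_nonneg_of_le_pi h3.le hsp')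
          have := Real.neg_one_le_sin s
          nlinarith
        · have g1 : 2 / 3 < s / (3 / 2 * Real.pi) := by
            rw [lt_div_iff₀ (by positivity)]
            linarith
          have g2 : 2 / 3 < s' / (3 / 2 * Real.pi) := by
            rw [lt_div_iff₀ (by positivity)]
            linarith
          linarith
    have same : r * Real.sin s = r' * Real.sin s' → r = r' ∧ s = s' := by
      intro h
      have hcos : r * Real.cos s = r' * Real.cos s' := by linarith
      have hrr : r = r' := by
        have : r ^ 2 = r' ^ 2 := by
          calc r ^ 2 = (r * Real.sin s) ^ 2 + (r * Real.cos s) ^ 2 := by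
                linear_combination (-r ^ 2) * Real.sin_sq_add_cos_sq s
            _ = (r' * Real.sin s') ^ 2 + (r' * Real.cos s') ^ 2 := by rw [h, hcos]
            _ = r' ^ 2 := by
                linear_combination (r' ^ 2) * Real.sin_sq_add_cos_sq s'
        exact (pow_left_inj₀ r0.le r0'.le two_ne_zero).1 this
      subst hrr
      have hS := mul_left_cancel₀ r0.ne' h
      have hC := mul_left_cancel₀ r0.ne' hcos
      have h1 : Real.cos (s - s') = 1 := by
        rw [Real.cos_sub, hS, hC]
        linear_combination Real.sin_sq_add_cos_sq s'
      have h2 := (Real.cos_eq_one_iff_of_lt_of_lt (by linarith) (by linarith)).1 h1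
      exact ⟨rfl, by linarith⟩
    have fin : r = r' → s = s' → p.exitPoint u 1 = p.exitPoint w 1 →
        (0 < u 0 ∧ 0 < w 0 ∨ u 0 < 0 ∧ w 0 < 0) → (u, t) = (w, t') := by
      intro hrr hss h1 hsg
      have hc0 : 0 < s / (3 / 2 * Real.pi) := by positivity
      have hc1 : s / (3 / 2 * Real.pi) < 1 := by
        rw [div_lt_one (by positivity)]
        exact s1
      have h2 : p.exitPoint u 2 = p.exitPoint w 2 := by
        rw [hr, hr', ← hss] at hrr
        unfold rotRadius at hrr
        set c := s / (3 / 2 * Real.pi)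
        have hz : (1 - c + c * p.theta) * (p.exitPoint u 2 - p.exitPoint w 2) = 0 := by
          linear_combination -hrr
        have hpos : 0 < 1 - c + c * p.theta := by
          have := mul_pos hc0 hp.theta_pos
          linarith
        have := (mul_eq_zero.1 hz).resolve_left hpos.ne'
        linarith
      have hT : p.timeToSigma u = p.timeToSigma w := by
        rw [c2, d2] at h2
        exact mul_left_cancel₀ (neg_ne_zero.2 l3.ne') (Real.exp_injective h2)
      have h0 : |u 0| = |w 0| := by
        have := exp_timeToSigma hp au
        rw [hT, exp_timeToSigma hp bw, one_div, one_div] at this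
        exact (inv_injective this).symm
      refine key ?_ ?_ (by rw [ht, ht', hT, hss])
      · rcases hsg with ⟨g1, g2⟩ | ⟨g1, g2⟩
        · rwa [abs_of_pos g1, abs_of_pos g2] at h0
        · rw [abs_of_neg g1, abs_of_neg g2] at h0
          linarith
      · have e1 : p.exitPoint u 1 = u 1 * Real.exp (-p.lam2 * p.timeToSigma u) := by
          simp [exitPoint, linFlow]
        have f1 : p.exitPoint w 1 = w 1 * Real.exp (-p.lam2 * p.timeToSigma w) := by
          simp [exitPoint, linFlow]
        rw [e1, f1, hT] at h1
        exact mul_right_cancel₀ (Real.exp_pos _).ne' h1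
    rcases hs with ⟨p0, q0, q1⟩ | ⟨p0, q0, q1⟩ <;> rcases hs' with ⟨p0', q0', q1'⟩ | ⟨p0', q0', q1'⟩
    · obtain ⟨hrr, hss⟩ := same (by linarith)
      exact fin hrr hss (by rw [← hss] at q1'; linarith) (Or.inl ⟨p0, p0'⟩)
    · exact (cross s r s' r' _ _ s0 s1 s0' s1' r0 r1 r0' r1' c1.2 d1.1 q0 q0' q1 q1').elim
    · exact (cross s' r' s r _ _ s0' s1' s0 s1 r0' r1' r0 r1 d1.2 c1.1 q0' q0 q1' q1).elim
    · obtain ⟨hrr, hss⟩ := same (by linarith)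
      exact fin hrr hss (by rw [← hss] at q1'; linarith) (Or.inr ⟨p0, p0'⟩)

end Params

end GeoLorenz

end

namespace GeoLorenz

namespace Params

variable {p : Params}

/-! Write the true initial point as `u`, reached at time `t` from `a ∈ S`, and a point of the
support as `v`, reached at time `s` from `b ∈ S`; the two paths thus leave `S` at the times `-t` and
`-s`. Every likelihood factor is an indicator of the cube, so membership of `v` in the support means
that all observations up to time `k h` are compatible with `v` (`Compatible`). As the noise lies in
the same cube, the two orbits are then `2ε`-close in every coordinate at the observation times
(`Close`).

Closeness determines the leaf. Just after a return of one orbit, its third coordinate is near `1`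
and its first coordinate is moderate, and this forces the other orbit to be near `S` as well
(`Small.near_section`). Hence the returns match in time, up to `2D` (`Small.match_return`,
`Small.sync`). The second coordinate after a return reveals the lobe just visited, so matched
returns come from the same side (`Small.same_side`). On each side the one-dimensional return map
expands distances by at least `√2` (`Admissible.lorenzMap_expanding`), while distances in `S` stay
at most `1`; so `n` matched returns force `|a 0 - b 0| ≤ √2 ^ (-n)`.

Closeness does not determine the phase: a small time shift between the orbits survives for ever. The
noise removes it. Once the leaf coordinates agree, the return times agree too, so a shift present at
the start is still present after the `n`-th return, where it displaces the third coordinate `exp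
(-λ₃ s)` by a definite amount. By Borel–Cantelli the noise almost surely comes arbitrarily close to
both faces `±ε` at such moments, and any fixed displacement then pushes the observation out of the
cube (`Small.noise_limit`).

Finally the first and third coordinates of a point depend continuously on its leaf coordinate and
its phase only, while the observation at time `0` bounds the second coordinate by `2ε`
(`Small.compatible_limit`). Null sets are discarded: points whose path runs into the stable manifold
`u₁ = 0` of the origin, and the planes where the formula for the path changes. -/

theorem Admissible.lam2_pos (hp : p.Admissible) : 0 < p.lam2 := hp.lam1_pos.trans hp.lam1_lt_lam2

theorem Admissible.alpha_pos (hp : p.Admissible) : 0 < p.alpha := div_pos hp.lam3_pos hp.lam1_pos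

theorem Admissible.timeToSigma_pos (hp : p.Admissible) {u : E3} (hu : u ∈ returnSquare)
    (h0 : u 0 ≠ 0) : 0 < p.timeToSigma u :=
  (div_pos (Real.log_pos (by norm_num)) hp.lam1_pos).trans_le (log_two_le_timeToSigma hp hu h0)

theorem Admissible.four_lt_returnTime (hp : p.Admissible) {u : E3} (hu : u ∈ returnSquare)
    (h0 : u 0 ≠ 0) : 4 < p.returnTime u := by
  have := hp.timeToSigma_pos hu h0
  have := Real.pi_gt_three
  unfold returnTime
  linarith

/-! ### The recursion for orbits -/

theorem orbitAux_of_lt {u : E3} {t : ℝ} (h : u 0 = 0 ∨ t < p.returnTime u) (n : ℕ) :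
    p.orbitAux n u t = p.excursion u t := by
  cases n with
  | zero => rfl
  | succ n => rw [orbitAux, if_pos h]

theorem orbit_of_lt {u : E3} {t : ℝ} (h : u 0 = 0 ∨ t < p.returnTime u) :
    p.orbit u t = p.excursion u t := orbitAux_of_lt h _

/-- Each return takes more than one unit of time, so any bound on the number of returns that exceeds
`t - 1` is never exhausted and its value is irrelevant. -/
theorem Admissible.orbitAux_congr (hp : p.Admissible) (n m : ℕ) {u : E3} (hu : u ∈ returnSquare)
    {t : ℝ} (hn : t < n + 1) (hm : t < m + 1) : p.orbitAux n u t = p.orbitAux m u t := by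
  induction n generalizing m u t with
  | zero =>
    have h : u 0 = 0 ∨ t < p.returnTime u := by
      refine or_iff_not_imp_left.2 fun h0 => ?_
      have := hp.four_lt_returnTime hu h0
      norm_num at hn
      linarith
    rw [orbitAux_of_lt h, orbitAux_of_lt h]
  | succ n ih =>
    by_cases h : u 0 = 0 ∨ t < p.returnTime u
    · rw [orbitAux_of_lt h, orbitAux_of_lt h]
    · have h0 : u 0 ≠ 0 := fun h0 => h (Or.inl h0)
      have hT := hp.four_lt_returnTime hu h0
      have ht : p.returnTime u ≤ t := not_lt.1 fun h1 => h (Or.inr h1)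
      cases m with
      | zero => norm_num at hm; linarith
      | succ m =>
        push_cast at hn hm
        rw [orbitAux, orbitAux, if_neg h, if_neg h]
        exact ih m (returnMap_mem hp hu h0) (by linarith) (by linarith)

theorem Admissible.orbit_of_le (hp : p.Admissible) {u : E3} (hu : u ∈ returnSquare)
    (h0 : u 0 ≠ 0) {t : ℝ} (ht : p.returnTime u ≤ t) :
    p.orbit u t = p.orbit (p.returnMap u) (t - p.returnTime u) := by
  have hT := hp.four_lt_returnTime hu h0
  have h1 : ⌊t⌋₊ ≠ 0 := (Nat.floor_pos.2 (by linarith)).ne'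
  obtain ⟨n, hn⟩ := Nat.exists_eq_succ_of_ne_zero h1
  have h2 := Nat.lt_floor_add_one t
  rw [orbit, hn, orbitAux, if_neg (by rintro (h | h); exacts [h0 h, by linarith])]
  rw [hn] at h2
  push_cast at h2
  exact hp.orbitAux_congr _ _ (returnMap_mem hp hu h0) (by linarith) (Nat.lt_floor_add_one _)

/-- The time of the `n`-th return to `S`. -/
noncomputable def nthReturn (p : Params) (n : ℕ) (a : E3) : ℝ :=
  ∑ i ∈ Finset.range n, p.returnTime (p.returnMap^[i] a)

theorem nthReturn_zero (a : E3) : p.nthReturn 0 a = 0 := by simp [nthReturn]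

theorem nthReturn_succ (n : ℕ) (a : E3) :
    p.nthReturn (n + 1) a = p.nthReturn n a + p.returnTime (p.returnMap^[n] a) := by
  simp [nthReturn, Finset.sum_range_succ]

theorem Admissible.iterate_mem (hp : p.Admissible) {a : E3} (ha : a ∈ returnSquare) {n : ℕ}
    (h0 : ∀ i < n, p.returnMap^[i] a 0 ≠ 0) : p.returnMap^[n] a ∈ returnSquare := by
  induction n with
  | zero => exact ha
  | succ n ih =>
    rw [Function.iterate_succ_apply']
    exact returnMap_mem hp (ih fun i hi => h0 i (by omega)) (h0 n (by omega))

theorem Admissible.four_mul_le_nthReturn (hp : p.Admissible) {a : E3} (ha : a ∈ returnSquare)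
    {n : ℕ} (h0 : ∀ i < n, p.returnMap^[i] a 0 ≠ 0) : 4 * (n : ℝ) ≤ p.nthReturn n a := by
  induction n with
  | zero => simp [nthReturn_zero]
  | succ n ih =>
    have h1 := ih fun i hi => h0 i (by omega)
    have h2 := hp.four_lt_returnTime (hp.iterate_mem ha fun i hi => h0 i (by omega))
      (h0 n (by omega))
    rw [nthReturn_succ]
    push_cast
    linarith

theorem Admissible.orbit_iterate (hp : p.Admissible) {a : E3} (ha : a ∈ returnSquare) {n : ℕ}
    (h0 : ∀ i < n, p.returnMap^[i] a 0 ≠ 0) {t : ℝ} (ht : p.nthReturn n a ≤ t) :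
    p.orbit a t = p.orbit (p.returnMap^[n] a) (t - p.nthReturn n a) := by
  induction n with
  | zero => simp [nthReturn_zero]
  | succ n ih =>
    have hm := hp.iterate_mem ha fun i hi => h0 i (Nat.lt_succ_of_lt hi)
    have h1 := hp.four_lt_returnTime hm (h0 n (by omega))
    rw [nthReturn_succ] at ht
    rw [ih (fun i hi => h0 i (by omega)) (by linarith),
      hp.orbit_of_le hm (h0 n (by omega)) (by linarith), nthReturn_succ,
      Function.iterate_succ_apply', sub_sub]

/-! ### Coordinates of the return map -/

theorem linFlow_zero (t : ℝ) (u : E3) : p.linFlow t u 0 = u 0 * Real.exp (p.lam1 * t) := by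
  simp [linFlow]

theorem linFlow_one (t : ℝ) (u : E3) : p.linFlow t u 1 = u 1 * Real.exp (-p.lam2 * t) := by
  simp [linFlow]

theorem linFlow_two (t : ℝ) (u : E3) : p.linFlow t u 2 = u 2 * Real.exp (-p.lam3 * t) := by
  simp [linFlow]

theorem Admissible.exitPoint_two (hp : p.Admissible) {u : E3} (hu : u ∈ returnSquare)
    (h0 : u 0 ≠ 0) : p.exitPoint u 2 = |u 0| ^ p.alpha := by
  have h1 := hp.lam1_pos
  have h2 : 0 < |u 0| := abs_pos.2 h0
  rw [exitPoint, linFlow_two, hu.2.2, one_mul, Real.rpow_def_of_pos h2]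
  congr 1
  unfold timeToSigma alpha
  rw [one_div |u 0|, Real.log_inv]
  field_simp

theorem Admissible.exitPoint_zero_pos_iff (hp : p.Admissible) {u : E3} (hu : u ∈ returnSquare)
    (h0 : u 0 ≠ 0) : 0 < p.exitPoint u 0 ↔ 0 < u 0 := by
  rw [(exitPoint_bounds hp hu h0).1]
  exact div_pos_iff_of_pos_right (abs_pos.2 h0)

theorem sin_three_halves_pi : Real.sin (3 / 2 * Real.pi) = -1 := by
  rw [show 3 / 2 * Real.pi = Real.pi / 2 + Real.pi by ring, Real.sin_add_pi, Real.sin_pi_div_two]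

theorem cos_three_halves_pi : Real.cos (3 / 2 * Real.pi) = 0 := by
  rw [show 3 / 2 * Real.pi = Real.pi / 2 + Real.pi by ring, Real.cos_add_pi, Real.cos_pi_div_two,
    neg_zero]

/-- The one-dimensional return map. -/
noncomputable def lorenzMap (p : Params) (x : ℝ) : ℝ :=
  if 0 < x then p.theta * |x| ^ p.alpha - 1 / 2 else 1 / 2 - p.theta * |x| ^ p.alpha

theorem Admissible.returnMap_zero (hp : p.Admissible) {u : E3} (hu : u ∈ returnSquare)
    (h0 : u 0 ≠ 0) : p.returnMap u 0 = p.lorenzMap (u 0) := by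
  have hd : 3 / 2 * Real.pi / (3 / 2 * Real.pi) = 1 :=
    div_self (mul_pos (by norm_num) Real.pi_pos).ne'
  simp only [returnMap, rotFlow, lorenzMap, hp.exitPoint_zero_pos_iff hu h0]
  split_ifs <;> simp only [Matrix.cons_val_zero, sin_three_halves_pi, rotRadius,
    hp.exitPoint_two hu h0, hd] <;> ring

theorem Admissible.returnMap_one_of_pos (hp : p.Admissible) {u : E3} (hu : u ∈ returnSquare)
    (h0 : 0 < u 0) : p.returnMap u 1 < -(1 / 12) := by
  have hd : 3 / 2 * Real.pi / (3 / 2 * Real.pi) = 1 :=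
    div_self (mul_pos (by norm_num) Real.pi_pos).ne'
  have h1 := (abs_lt.1 (exitPoint_bounds hp hu h0.ne').2.1).2
  simp only [returnMap, rotFlow, if_pos ((hp.exitPoint_zero_pos_iff hu h0.ne').2 h0), hd,
    PiLp.toLp_apply, Matrix.cons_val_one, Matrix.cons_val_zero]
  linarith

theorem Admissible.returnMap_one_of_neg (hp : p.Admissible) {u : E3} (hu : u ∈ returnSquare)
    (h0 : u 0 < 0) : 1 / 12 < p.returnMap u 1 := by
  have hd : 3 / 2 * Real.pi / (3 / 2 * Real.pi) = 1 :=
    div_self (mul_pos (by norm_num) Real.pi_pos).ne'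
  have h1 := (abs_lt.1 (exitPoint_bounds hp hu h0.ne).2.1).1
  simp only [returnMap, rotFlow, if_neg (mt (hp.exitPoint_zero_pos_iff hu h0.ne).1 h0.not_gt), hd,
    PiLp.toLp_apply, Matrix.cons_val_one, Matrix.cons_val_zero]
  linarith

/-! ### Expansion of the one-dimensional return map -/

theorem Admissible.sqrt_two_lt (hp : p.Admissible) :
    √2 < p.theta * p.alpha * (1 / 2 : ℝ) ^ (p.alpha - 1) := by
  have ha := hp.alpha_pos
  have h2 : (0 : ℝ) < √2 := by positivity
  have h3 : (0 : ℝ) < 2 ^ p.alpha := by positivity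
  have h4 := hp.theta_gt
  rw [div_lt_iff₀ (by positivity)] at h4
  have h5 : (1 / 2 : ℝ) ^ (p.alpha - 1) = 2 / 2 ^ p.alpha := by
    rw [one_div, Real.inv_rpow (by norm_num), Real.rpow_sub (by norm_num), Real.rpow_one, inv_div]
  rw [h5, ← mul_div_assoc, lt_div_iff₀ h3]
  have h6 : √2 * √2 = 2 := Real.mul_self_sqrt (by norm_num)
  calc √2 * 2 ^ p.alpha < √2 * (p.theta * (√2 * p.alpha)) := mul_lt_mul_of_pos_left h4 h2
    _ = p.theta * p.alpha * 2 := by linear_combination p.theta * p.alpha * h6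

/-- Concavity of `x ^ α`: the graph lies below its tangent at `y` (Bernoulli's inequality), and the
slope there is at least the slope at `1/2`, which exceeds `√2` by the lower bound on `θ`. -/
theorem Admissible.expand_of_lt (hp : p.Admissible) {x y : ℝ} (hx : 0 < x) (hxy : x ≤ y)
    (hy : y ≤ 1 / 2) :
    √2 * (y - x) ≤ p.theta * y ^ p.alpha - p.theta * x ^ p.alpha := by
  have ha := hp.alpha_pos
  have hy0 : 0 < y := hx.trans_le hxy
  have h1 : x ^ p.alpha ≤ y ^ p.alpha + p.alpha * y ^ (p.alpha - 1) * (x - y) := by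
    have h := rpow_one_add_le_one_add_mul_self (s := (x - y) / y)
      (by rw [le_div_iff₀ hy0]; linarith) ha.le hp.alpha_lt.le
    have e : 1 + (x - y) / y = x / y := by field_simp; ring
    rw [e, Real.div_rpow hx.le hy0.le, div_le_iff₀ (by positivity)] at h
    rw [Real.rpow_sub_one hy0.ne']
    calc x ^ p.alpha ≤ (1 + p.alpha * ((x - y) / y)) * y ^ p.alpha := h
      _ = _ := by field_simp
  have h2 : (1 / 2 : ℝ) ^ (p.alpha - 1) ≤ y ^ (p.alpha - 1) :=
    Real.rpow_le_rpow_of_nonpos hy0 hy (by linarith [hp.alpha_lt])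
  have h3 : √2 ≤ p.theta * p.alpha * y ^ (p.alpha - 1) :=
    hp.sqrt_two_lt.le.trans (mul_le_mul_of_nonneg_left h2 (mul_pos hp.theta_pos ha).le)
  have h4 := mul_le_mul_of_nonneg_left h1 hp.theta_pos.le
  have h5 := mul_le_mul_of_nonneg_right h3 (sub_nonneg.2 hxy)
  linarith

theorem Admissible.expand_pos (hp : p.Admissible) {x y : ℝ} (hx : 0 < x) (hx' : x ≤ 1 / 2)
    (hy : 0 < y) (hy' : y ≤ 1 / 2) :
    √2 * |x - y| ≤ |p.theta * x ^ p.alpha - p.theta * y ^ p.alpha| := by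
  rcases le_total x y with h | h
  · rw [abs_sub_comm, abs_of_nonneg (sub_nonneg.2 h), abs_sub_comm]
    exact (hp.expand_of_lt hx h hy').trans (le_abs_self _)
  · rw [abs_of_nonneg (sub_nonneg.2 h)]
    exact (hp.expand_of_lt hy h hx').trans (le_abs_self _)

theorem Admissible.lorenzMap_expanding (hp : p.Admissible) {x y : ℝ} (hx : |x| ≤ 1 / 2)
    (hy : |y| ≤ 1 / 2) (hxy : 0 < x * y) :
    √2 * |x - y| ≤ |p.lorenzMap x - p.lorenzMap y| := by
  rcases pos_and_pos_or_neg_and_neg_of_mul_pos hxy with ⟨h1, h2⟩ | ⟨h1, h2⟩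
  · rw [abs_of_pos h1] at hx
    rw [abs_of_pos h2] at hy
    rw [lorenzMap, lorenzMap, if_pos h1, if_pos h2, abs_of_pos h1, abs_of_pos h2]
    convert hp.expand_pos h1 hx h2 hy using 2
    ring
  · have e : |x - y| = |-x - -y| := by rw [← abs_neg]; congr 1; ring
    rw [abs_of_neg h1] at hx
    rw [abs_of_neg h2] at hy
    rw [lorenzMap, lorenzMap, if_neg h1.not_gt, if_neg h2.not_gt, abs_of_neg h1, abs_of_neg h2, e,
      ← abs_neg (_ - _ : ℝ), ← abs_neg (1 / 2 - _ - _ : ℝ)]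
    rw [abs_neg (-x - -y)]
    convert hp.expand_pos (neg_pos.2 h1) hx (neg_pos.2 h2) hy using 2
    ring

end Params

end GeoLorenz

namespace GeoLorenz

namespace Params

variable {p : Params}

/-! ### Matching the returns of two orbits that stay close at the observation times -/

/-- The time tolerance `D`, the observation step `h` and the noise level `ε` are small. -/
structure Small (p : Params) (D h ε : ℝ) : Prop where
  D_pos : 0 < D
  D_le : D ≤ 1 / 100
  -- For `10 D` units of time after a visit to `S` a path is still in its linear phase, and its
  -- second coordinate has changed by at most `1/20`.
  D_lam1 : 10 * D * p.lam1 ≤ Real.log 2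
  D_lam2 : 10 * D * p.lam2 ≤ 1 / 10
  h_pos : 0 < h
  h_le : h ≤ D
  eps_pos : 0 < ε
  eps_le : ε ≤ 1 / 100
  -- These three bounds serve `near_section`: `gap` bounds the age of a nearby path in the linear
  -- phase, `height` the time left in the rotation phase, and `width` keeps the first coordinate
  -- away from `±1`.
  gap : Real.exp (-p.lam3 * D) < Real.exp (-p.lam3 * h) - 2 * ε
  height : 7 * (1 - Real.exp (-p.lam3 * h) + 2 * ε) ≤ D
  width : Real.exp (p.lam1 * h) / 2 + 2 * ε ≤ 3 / 4

theorem Admissible.exists_small (hp : p.Admissible) :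
    ∃ D hmax εmax : ℝ, 0 < hmax ∧ 0 < εmax ∧
      ∀ h ε, 0 < h → h ≤ hmax → 0 < ε → ε ≤ εmax → p.Small D h ε := by
  have l1 := hp.lam1_pos
  have l2 := hp.lam2_pos
  have l3 := hp.lam3_pos
  have hlog : (0 : ℝ) < Real.log 2 := Real.log_pos (by norm_num)
  obtain ⟨D, hD, hD1⟩ : ∃ D : ℝ, 0 < D ∧
      D ≤ min (1 / 100) (min (Real.log 2 / (10 * p.lam1)) (1 / (100 * p.lam2))) :=
    ⟨_, by positivity, le_rfl⟩
  simp only [le_min_iff] at hD1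
  obtain ⟨d1, d2, d3⟩ := hD1
  rw [le_div_iff₀ (by positivity)] at d2 d3
  have g : 0 < 1 - Real.exp (-p.lam3 * D) := by
    rw [sub_pos, Real.exp_lt_one_iff]
    nlinarith
  obtain ⟨H, hH, hH1⟩ : ∃ H : ℝ, 0 < H ∧ H ≤ min (min D (Real.log (5 / 4) / p.lam1))
      (min ((1 - Real.exp (-p.lam3 * D)) / (2 * p.lam3)) (D / (14 * p.lam3))) :=
    ⟨_, by have : 0 < Real.log (5 / 4) := Real.log_pos (by norm_num)
           positivity, le_rfl⟩
  obtain ⟨E, hE, hE1⟩ : ∃ E : ℝ, 0 < E ∧ E ≤ min (1 / 100)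
      (min ((1 - Real.exp (-p.lam3 * D)) / 8) (D / 28)) := ⟨_, by positivity, le_rfl⟩
  simp only [le_min_iff] at hH1 hE1
  refine ⟨D, H, E, hH, hE, fun h ε h0 hh e0 he => ?_⟩
  obtain ⟨⟨a1, a2⟩, a3, a4⟩ := hH1
  obtain ⟨b1, b2, b3⟩ := hE1
  have a1 := hh.trans a1
  have a2 := hh.trans a2
  have a3 := hh.trans a3
  have a4 := hh.trans a4
  rw [le_div_iff₀ (by positivity)] at a2 a3 a4
  have k : 1 - p.lam3 * h ≤ Real.exp (-p.lam3 * h) := by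
    have := Real.add_one_le_exp (-p.lam3 * h)
    linarith
  have w : Real.exp (p.lam1 * h) ≤ 5 / 4 := by
    rw [← Real.le_log_iff_exp_le (by norm_num)]
    linarith
  exact ⟨hD, d1, by linarith, by linarith, h0, a1, e0, he.trans b1, by linarith, by linarith,
    by linarith⟩

variable {D h ε : ℝ}

theorem excursion_eq_linFlow {u : E3} {t : ℝ} (ht : u 0 = 0 ∨ t ≤ p.timeToSigma u) :
    p.excursion u t = p.linFlow t u := if_pos ht

theorem Small.le_timeToSigma (hs : p.Small D h ε) (hp : p.Admissible) {u : E3}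
    (hu : u ∈ returnSquare) (h0 : u 0 ≠ 0) : 10 * D ≤ p.timeToSigma u :=
  ((le_div_iff₀ hp.lam1_pos).2 hs.D_lam1).trans (log_two_le_timeToSigma hp hu h0)

theorem Small.excursion_short (hs : p.Small D h ε) (hp : p.Admissible) {u : E3}
    (hu : u ∈ returnSquare) {t : ℝ} (ht : t ≤ 10 * D) : p.excursion u t = p.linFlow t u :=
  excursion_eq_linFlow <| or_iff_not_imp_left.2 fun h0 => ht.trans (hs.le_timeToSigma hp hu h0)

theorem Small.orbit_short (hs : p.Small D h ε) (hp : p.Admissible) {u : E3}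
    (hu : u ∈ returnSquare) {t : ℝ} (ht : t ≤ 10 * D) : p.orbit u t = p.linFlow t u := by
  rw [orbit_of_lt, hs.excursion_short hp hu ht]
  refine or_iff_not_imp_left.2 fun h0 => ?_
  have := hp.four_lt_returnTime hu h0
  linarith [hs.D_le]

theorem exists_nat_mul (hh : 0 < h) {t : ℝ} (ht : 0 ≤ t) : ∃ i : ℕ, t ≤ i * h ∧ i * h < t + h := by
  refine ⟨⌈t / h⌉₊, ?_, ?_⟩
  · rw [← div_le_iff₀ hh]
    exact Nat.le_ceil _
  · have := Nat.ceil_lt_add_one (div_nonneg ht hh.le)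
    rw [← lt_div_iff₀ hh, add_div, div_self hh.ne']
    exact this

/-- A path close to a path that has just started from `S` has just left `S` or is about to return
to it. -/
theorem Small.near_section (hs : p.Small D h ε) (hp : p.Admissible) {a b : E3}
    (ha : a ∈ returnSquare) (hb : b ∈ returnSquare) {σ s : ℝ} (hσ0 : 0 ≤ σ) (hσ : σ < h)
    (hbs : p.BeforeReturn b s) (hc : ∀ j, |p.orbit a σ j - p.excursion b s j| ≤ 2 * ε) :
    s ≤ D ∨ (b 0 ≠ 0 ∧ p.returnTime b - s ≤ D) := by
  have hlin := hs.orbit_short hp ha (t := σ) (by linarith [hs.h_le, hs.D_pos])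
  have c0 := hc 0
  have c2 := hc 2
  rw [hlin, linFlow_zero] at c0
  rw [hlin, linFlow_two, ha.2.2, one_mul] at c2
  have l1 := hp.lam1_pos
  have l3 := hp.lam3_pos
  have z1 : Real.exp (-p.lam3 * σ) ≤ 1 := Real.exp_le_one_iff.2 (by nlinarith)
  have z2 : Real.exp (-p.lam3 * h) ≤ Real.exp (-p.lam3 * σ) := Real.exp_le_exp.2 (by nlinarith)
  have x1 : |a 0 * Real.exp (p.lam1 * σ)| ≤ Real.exp (p.lam1 * h) / 2 := by
    rw [abs_mul, abs_of_pos (Real.exp_pos _)]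
    have := Real.exp_le_exp.2 (mul_le_mul_of_nonneg_left hσ.le l1.le)
    nlinarith [ha.1, Real.exp_pos (p.lam1 * σ)]
  have hg := hs.gap
  have hh := hs.height
  have hw := hs.width
  have hO : p.IsOrigin (p.excursion b s) (b, s) := ⟨hb, hbs, rfl⟩
  rw [abs_le] at c2
  have x2 : |p.excursion b s 0| ≤ 3 / 4 := by
    rw [abs_le] at *
    constructor <;> linarith
  rcases hO.cases hp with ⟨hv, -, -⟩ | ⟨b0, -, s', r, s0, s1, ht, -, r0, r1, v2, hv⟩
  · left
    simp only at hv
    rw [hv, linFlow_two, hb.2.2, one_mul] at c2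
    have : Real.exp (-p.lam3 * D) < Real.exp (-p.lam3 * s) := by linarith
    rw [Real.exp_lt_exp] at this
    nlinarith
  · right
    simp only at b0 ht hv
    refine ⟨b0, ?_⟩
    rw [abs_le] at x2
    -- A first coordinate of size at most `3/4` puts the path in the last quarter turn with `r ≥
    -- 1/4`. Its height there is `1 + r sin φ`, with `φ` the time left, so Jordan's inequality
    -- bounds `φ`; the `7` in `height` dominates `2π`.
    have y1 : r * Real.sin s' ≤ -(1 / 4) := by
      rcases hv with ⟨-, h, -⟩ | ⟨-, h, -⟩ <;> rw [h] at x2 <;> linarith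
    have y2 : Real.sin s' < 0 := by
      by_contra hcon
      nlinarith
    have y3 : Real.pi < s' := by
      by_contra hcon
      exact absurd (Real.sin_nonneg_of_nonneg_of_le_pi s0.le (not_lt.1 hcon)) (not_le.2 y2)
    have y4 : 1 / 4 ≤ r := by nlinarith [Real.neg_one_le_sin s']
    have hpi := Real.pi_pos
    have y5 : Real.cos s' = -Real.sin (3 / 2 * Real.pi - s') := by
      rw [Real.sin_sub, sin_three_halves_pi, cos_three_halves_pi]
      ring
    have y6 : 2 / Real.pi * (3 / 2 * Real.pi - s') ≤ Real.sin (3 / 2 * Real.pi - s') :=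
      Real.mul_le_sin (by linarith) (by linarith)
    rw [v2, y5] at c2
    set φ := 3 / 2 * Real.pi - s' with hφ
    have φ0 : 0 < φ := by linarith
    have y7 : 0 < 2 / Real.pi * φ := by positivity
    have y8 : 1 / 4 * Real.sin φ ≤ r * Real.sin φ := by
      apply mul_le_mul_of_nonneg_right y4
      linarith
    have y9 : 2 / Real.pi * φ ≤ 4 * (1 - Real.exp (-p.lam3 * h) + 2 * ε) := by linarith
    have y10 : φ ≤ Real.pi / 2 * (4 * (1 - Real.exp (-p.lam3 * h) + 2 * ε)) := by
      calc φ = Real.pi / 2 * (2 / Real.pi * φ) := by field_simp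
        _ ≤ _ := by gcongr
    have y11 : p.returnTime b - s = φ := by
      rw [returnTime, ht]
      ring
    rw [y11]
    nlinarith [Real.pi_lt_d2]

/-- The orbits started from `a` at the time `ta` and from `b` at the time `tb` are `2ε`-close at
all observation times up to `K`. -/
def Close (p : Params) (h ε K : ℝ) (a : E3) (ta : ℝ) (b : E3) (tb : ℝ) : Prop :=
  ∀ i : ℕ, ta ≤ i * h → tb ≤ i * h → i * h ≤ K →
    ∀ j, |p.orbit a (i * h - ta) j - p.orbit b (i * h - tb) j| ≤ 2 * ε

variable {a b : E3} {K ta tb : ℝ}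

theorem Close.symm (hc : p.Close h ε K a ta b tb) : p.Close h ε K b tb a ta := by
  intro i h1 h2 h3 j
  rw [abs_sub_comm]
  exact hc i h2 h1 h3 j

theorem Close.shift_left (hc : p.Close h ε K a ta b tb) (hp : p.Admissible) (ha : a ∈ returnSquare)
    {n : ℕ} (h0 : ∀ i < n, p.returnMap^[i] a 0 ≠ 0) :
    p.Close h ε K (p.returnMap^[n] a) (ta + p.nthReturn n a) b tb := by
  intro i h1 h2 h3 j
  have h4 : (0 : ℝ) ≤ 4 * n := by positivity
  have h5 := hp.four_mul_le_nthReturn ha h0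
  rw [← sub_sub, ← hp.orbit_iterate ha h0 (by linarith)]
  exact hc i (by linarith) h2 h3 j

theorem Close.shift (hc : p.Close h ε K a ta b tb) (hp : p.Admissible) (ha : a ∈ returnSquare)
    (hb : b ∈ returnSquare) {n : ℕ} (h0 : ∀ i < n, p.returnMap^[i] a 0 ≠ 0)
    (h0' : ∀ i < n, p.returnMap^[i] b 0 ≠ 0) :
    p.Close h ε K (p.returnMap^[n] a) (ta + p.nthReturn n a)
      (p.returnMap^[n] b) (tb + p.nthReturn n b) :=
  ((hc.shift_left hp ha h0).symm.shift_left hp hb h0').symm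

/-- A return of the first orbit is close in time to a return of the second one, or else it is close
to the starting time of the second one, or the first return of the second one is close to the
starting time of the first one. -/
theorem Small.match_return (hs : p.Small D h ε) (hp : p.Admissible) (ha : a ∈ returnSquare)
    (hb : b ∈ returnSquare) (hc : p.Close h ε K a ta b tb) (a0 : a 0 ≠ 0)
    (h1 : 0 ≤ ta + p.returnTime a) (h2 : ta + p.returnTime a ≤ K - 1)
    (h3 : b 0 ≠ 0 → 0 ≤ tb + p.returnTime b) (h4 : tb ≤ ta + p.returnTime a)
    (h5 : b 0 ≠ 0 → ta ≤ tb + p.returnTime b) :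
    (b 0 ≠ 0 ∧ |ta + p.returnTime a - (tb + p.returnTime b)| ≤ 2 * D) ∨
    (b 0 ≠ 0 ∧ |ta - (tb + p.returnTime b)| ≤ 2 * D) ∨
    |ta + p.returnTime a - tb| ≤ 2 * D := by
  have hD := hs.D_pos
  have hD1 := hs.D_le
  have hh := hs.h_pos
  have hhD := hs.h_le
  have Ta := hp.four_lt_returnTime ha a0
  obtain ⟨i, i1, i2⟩ := exists_nat_mul hh h1
  -- If the second orbit has not yet returned at this observation time, `near_section` applies to it
  -- directly.
  by_cases hb1 : b 0 = 0 ∨ i * h - tb < p.returnTime b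
  · have ci := hc i (by linarith) (by linarith) (by linarith)
    rw [hp.orbit_of_le ha a0 (by linarith), orbit_of_lt hb1] at ci
    rcases hs.near_section hp (returnMap_mem hp ha a0) hb (by linarith) (by linarith)
      ⟨by linarith, fun h => hb1.resolve_left h⟩ ci with h6 | ⟨h6, h7⟩
    · right; right
      rw [abs_le]
      constructor <;> linarith
    · left
      refine ⟨h6, ?_⟩
      have := hb1.resolve_left h6
      rw [abs_le]
      constructor <;> linarith
  · push Not at hb1
    obtain ⟨b0, hb1⟩ := hb1
    by_cases hlt : ta + p.returnTime a - D ≤ tb + p.returnTime b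
    · left
      refine ⟨b0, ?_⟩
      rw [abs_le]
      constructor <;> linarith
    · push Not at hlt
      -- The second orbit returned more than `D ≥ h` earlier, so the first observation after its
      -- return still precedes the return of the first orbit, and the roles can be exchanged.
      obtain ⟨j, j1, j2⟩ := exists_nat_mul hh (h3 b0)
      have Tb := hp.four_lt_returnTime hb b0
      have h5 := h5 b0
      have cj := hc.symm j (by linarith) (by linarith) (by linarith)
      have hlt' : j * h - ta < p.returnTime a := by linarith
      rw [hp.orbit_of_le hb b0 (by linarith), orbit_of_lt (Or.inr hlt')] at cj
      rcases hs.near_section hp (returnMap_mem hp hb b0) ha (by linarith) (by linarith)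
        ⟨by linarith, fun _ => hlt'⟩ cj with h6 | ⟨-, h7⟩
      · right; left
        refine ⟨b0, ?_⟩
        rw [abs_le]
        constructor <;> linarith
      · left
        refine ⟨b0, ?_⟩
        rw [abs_le]
        constructor <;> linarith

/-- Close orbits return from the same side. -/
theorem Small.same_side (hs : p.Small D h ε) (hp : p.Admissible) (ha : a ∈ returnSquare)
    (hb : b ∈ returnSquare) (a0 : a 0 ≠ 0) (b0 : b 0 ≠ 0)
    (hc : p.Close h ε K (p.returnMap a) ta (p.returnMap b) tb) (hab : |ta - tb| ≤ 2 * D)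
    (h0 : 0 ≤ ta) (hK : ta ≤ K - 1) : 0 < a 0 * b 0 := by
  have hD := hs.D_pos
  have hD1 := hs.D_le
  have hh := hs.h_pos
  have hhD := hs.h_le
  rw [abs_le] at hab
  have ha' := returnMap_mem hp ha a0
  have hb' := returnMap_mem hp hb b0
  -- Waiting until `ta + 2D` guarantees that both orbits have left `S`.
  obtain ⟨i, i1, i2⟩ := exists_nat_mul hh (show 0 ≤ ta + 2 * D by linarith)
  have ci := hc i (by linarith) (by linarith) (by linarith) 1
  rw [hs.orbit_short hp ha' (by linarith), hs.orbit_short hp hb' (by linarith), linFlow_one,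
    linFlow_one] at ci
  have key : ∀ w : E3, w ∈ returnSquare → ∀ t, 0 ≤ t → t ≤ 10 * D →
      |w 1 - w 1 * Real.exp (-p.lam2 * t)| ≤ 1 / 20 := by
    intro w hw t ht ht'
    have e1 := Real.add_one_le_exp (-p.lam2 * t)
    have l2 := hp.lam2_pos
    have e2 : Real.exp (-p.lam2 * t) ≤ 1 := Real.exp_le_one_iff.2 (by nlinarith)
    have e3 : p.lam2 * t ≤ 1 / 10 := by nlinarith [hs.D_lam2]
    have e4 : w 1 - w 1 * Real.exp (-p.lam2 * t) = w 1 * (1 - Real.exp (-p.lam2 * t)) := by ring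
    rw [e4, abs_mul, abs_of_nonneg (by linarith : (0 : ℝ) ≤ 1 - Real.exp (-p.lam2 * t))]
    nlinarith [hw.2.1, abs_nonneg (w 1)]
  have k1 := abs_le.1 (key _ ha' (i * h - ta) (by linarith) (by linarith))
  have k2 := abs_le.1 (key _ hb' (i * h - tb) (by linarith) (by linarith))
  have he := hs.eps_le
  rw [abs_le] at ci
  -- Different lobes give second coordinates on `S` more than `1/6` apart, but these differ by at
  -- most `2ε + 2/20 ≤ 3/25`.
  rcases lt_or_gt_of_ne a0 with a1 | a1 <;> rcases lt_or_gt_of_ne b0 with b1 | b1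
  · exact mul_pos_of_neg_of_neg a1 b1
  · have := hp.returnMap_one_of_neg ha a1
    have := hp.returnMap_one_of_pos hb b1
    linarith
  · have := hp.returnMap_one_of_pos ha a1
    have := hp.returnMap_one_of_neg hb b1
    linarith
  · exact mul_pos a1 b1

/-- The tolerance `2D` does not accumulate: at each return it is re-established by the observations,
not inherited from the previous return. -/
theorem Small.sync (hs : p.Small D h ε) (hp : p.Admissible) (ha : a ∈ returnSquare)
    (hb : b ∈ returnSquare) (hc : p.Close h ε K a ta b tb) (hta : -2 ≤ ta)
    (hab : |ta - tb| ≤ 2 * D) (n : ℕ) (h0 : ∀ i < n, p.returnMap^[i] a 0 ≠ 0)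
    (hK : ta + p.nthReturn n a ≤ K - 1) :
    (∀ i < n, 0 < p.returnMap^[i] a 0 * p.returnMap^[i] b 0) ∧
      |ta + p.nthReturn n a - (tb + p.nthReturn n b)| ≤ 2 * D := by
  induction n with
  | zero => simpa [nthReturn_zero] using hab
  | succ n ih =>
    have h0n : ∀ i < n, p.returnMap^[i] a 0 ≠ 0 := fun i hi => h0 i (by omega)
    have an := hp.iterate_mem ha h0n
    have an0 := h0 n (by omega)
    have Ta := hp.four_lt_returnTime an an0
    rw [nthReturn_succ] at hK
    obtain ⟨ih1, ih2⟩ := ih h0n (by linarith)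
    have h0b : ∀ i < n, p.returnMap^[i] b 0 ≠ 0 := fun i hi => (right_ne_zero_of_mul (ih1 i hi).ne')
    have bn := hp.iterate_mem hb h0b
    have hcn := hc.shift hp ha hb h0n h0b
    have hn : (0 : ℝ) ≤ 4 * n := by positivity
    have h4 := hp.four_mul_le_nthReturn ha h0n
    have hD1 := hs.D_le
    have Tb : p.returnMap^[n] b 0 ≠ 0 → 4 < p.returnTime (p.returnMap^[n] b) :=
      hp.four_lt_returnTime bn
    have ih3 := abs_le.1 ih2
    have hm := hs.match_return hp an bn hcn an0 (by linarith) (by linarith)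
      (fun h => by have := Tb h; linarith) (by linarith) (fun h => by have := Tb h; linarith)
    have hm' : p.returnMap^[n] b 0 ≠ 0 ∧
        |ta + p.nthReturn (n + 1) a - (tb + p.nthReturn (n + 1) b)| ≤ 2 * D := by
      rw [nthReturn_succ, nthReturn_succ, ← add_assoc, ← add_assoc]
      -- The other two matchings would pair a return with the previous visit to `S`, which is more
      -- than `4` earlier.
      rcases hm with hm | ⟨hm1, hm2⟩ | hm
      · exact hm
      · have := Tb hm1
        rw [abs_le] at hm2
        linarith
      · rw [abs_le] at hm
        linarith
    obtain ⟨bn0, hm'⟩ := hm'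
    refine ⟨fun i hi => ?_, hm'⟩
    rcases Nat.lt_succ_iff_lt_or_eq.1 hi with hi | rfl
    · exact ih1 i hi
    · have hcn1 := hc.shift hp ha hb h0 (n := i + 1) fun k hk => by
        rcases Nat.lt_succ_iff_lt_or_eq.1 hk with hk | rfl
        exacts [h0b k hk, bn0]
      rw [Function.iterate_succ_apply', Function.iterate_succ_apply'] at hcn1
      refine hs.same_side hp an bn an0 bn0 hcn1 hm' ?_ ?_ <;> rw [nthReturn_succ] <;> linarith

/-- Expansion read backwards: the leaf coordinates after `n` returns from common sides differ by at
most the width `1` of `S`. -/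
theorem Admissible.contraction (hp : p.Admissible) (ha : a ∈ returnSquare) (hb : b ∈ returnSquare)
    {n : ℕ} (h0 : ∀ i < n, 0 < p.returnMap^[i] a 0 * p.returnMap^[i] b 0) :
    √2 ^ n * |a 0 - b 0| ≤ 1 := by
  have mem : ∀ m ≤ n, p.returnMap^[m] a ∈ returnSquare ∧ p.returnMap^[m] b ∈ returnSquare :=
    fun m hm => ⟨hp.iterate_mem ha fun i hi => left_ne_zero_of_mul (h0 i (by omega)).ne',
      hp.iterate_mem hb fun i hi => right_ne_zero_of_mul (h0 i (by omega)).ne'⟩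
  have key : ∀ m ≤ n, √2 ^ m * |a 0 - b 0| ≤ |p.returnMap^[m] a 0 - p.returnMap^[m] b 0| := by
    intro m hm
    induction m with
    | zero => simp
    | succ m ih =>
      have h1 := h0 m (by omega)
      obtain ⟨m1, m2⟩ := mem m (by omega)
      rw [Function.iterate_succ_apply', Function.iterate_succ_apply',
        hp.returnMap_zero m1 (left_ne_zero_of_mul h1.ne'),
        hp.returnMap_zero m2 (right_ne_zero_of_mul h1.ne')]
      refine le_trans ?_ (hp.lorenzMap_expanding m1.1 m2.1 h1)
      rw [pow_succ', mul_assoc]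
      exact mul_le_mul_of_nonneg_left (ih (by omega)) (by positivity)
  obtain ⟨m1, m2⟩ := mem n le_rfl
  have h1 := abs_le.1 m1.1
  have h2 := abs_le.1 m2.1
  refine (key n le_rfl).trans ?_
  rw [abs_le]
  constructor <;> linarith

end Params

end GeoLorenz

namespace GeoLorenz

namespace Params

variable {p : Params} {D h ε : ℝ} {a b : E3} {K ta tb : ℝ}

/-! ### Orbits that stay close for a long time -/

theorem Close.mono {K' : ℝ} (hc : p.Close h ε K a ta b tb) (hK : K' ≤ K) :
    p.Close h ε K' a ta b tb :=
  fun i h1 h2 h3 => hc i h1 h2 (h3.trans hK)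

theorem exists_returnTime_close {x : ℝ} (hx : x ≠ 0) {ρ : ℝ} (hρ : 0 < ρ) :
    ∃ δ > 0, ∀ u v : E3, u 0 = x → |x - v 0| ≤ δ → |p.returnTime u - p.returnTime v| ≤ ρ := by
  have hcont : ContinuousAt (fun y : ℝ => 1 / p.lam1 * Real.log (1 / |y|)) x := by
    have : |x| ≠ 0 := abs_ne_zero.2 hx
    have : 1 / |x| ≠ 0 := by positivity
    fun_prop (disch := assumption)
  obtain ⟨δ, hδ, hd⟩ := Metric.continuousAt_iff.1 hcont ρ hρ
  refine ⟨δ / 2, by positivity, fun u v hu hv => ?_⟩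
  have := hd (x := v 0) (by rw [Real.dist_eq, abs_sub_comm]; linarith)
  rw [Real.dist_eq, abs_sub_comm] at this
  simp only [returnTime, timeToSigma, hu, add_sub_add_right_eq_sub]
  exact this.le

theorem exists_nthReturn_close (n : ℕ) (h0 : ∀ i, p.returnMap^[i] a 0 ≠ 0) {ρ : ℝ} (hρ : 0 < ρ) :
    ∃ δ > 0, ∀ b : E3, (∀ i < n, |p.returnMap^[i] a 0 - p.returnMap^[i] b 0| ≤ δ) →
      |p.nthReturn n a - p.nthReturn n b| ≤ ρ := by
  induction n generalizing ρ with
  | zero => exact ⟨1, one_pos, fun b _ => by simp [nthReturn_zero, hρ.le]⟩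
  | succ n ih =>
    obtain ⟨δ, hδ, hd⟩ := ih (half_pos hρ)
    obtain ⟨δ', hδ', hd'⟩ := exists_returnTime_close (p := p) (h0 n) (half_pos hρ)
    refine ⟨min δ δ', lt_min hδ hδ', fun b hb => ?_⟩
    have h1 := abs_le.1 (hd b fun i hi => (hb i (by omega)).trans (min_le_left _ _))
    have h2 := abs_le.1 (hd' _ _ rfl ((hb n (by omega)).trans (min_le_right _ _)))
    rw [nthReturn_succ, nthReturn_succ, abs_le]
    constructor <;> linarith

/-- Matching `M` further returns makes the leaf coordinates at all of the first `n` returns as close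
as desired, hence also the return times. The last conclusion says that the time shift at the `n`-th
return is almost the initial shift. -/
theorem Small.sync_limit (hs : p.Small D h ε) (hp : p.Admissible) (ha : a ∈ returnSquare)
    (h0 : ∀ i, p.returnMap^[i] a 0 ≠ 0) (ta : ℝ) (n : ℕ) {ρ : ℝ} (hρ : 0 < ρ) :
    ∃ K₀, ∀ K ≥ K₀, ∀ b ∈ returnSquare, ∀ tb, -1 ≤ tb → |ta - tb| ≤ 2 * D →
      p.Close h ε K a ta b tb →
      |a 0 - b 0| ≤ ρ ∧ (∀ i < n, 0 < p.returnMap^[i] a 0 * p.returnMap^[i] b 0) ∧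
      |ta + p.nthReturn n a - (tb + p.nthReturn n b)| ≤ 2 * D ∧
      |p.nthReturn n a - p.nthReturn n b| ≤ ρ := by
  obtain ⟨δ, hδ, hd⟩ := exists_nthReturn_close n h0 hρ
  have hmin : 0 < min δ ρ := lt_min hδ hρ
  obtain ⟨M, hM⟩ := pow_unbounded_of_one_lt (1 / min δ ρ) Real.one_lt_sqrt_two
  rw [div_lt_iff₀ hmin] at hM
  refine ⟨ta + p.nthReturn (n + M) a + 1, fun K hK b hb tb htb hab hc => ?_⟩
  have hta : -2 ≤ ta := by
    have := (abs_le.1 hab).1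
    linarith [hs.D_le]
  obtain ⟨s1, -⟩ := hs.sync hp ha hb hc hta hab (n + M) (fun i _ => h0 i) (by linarith)
  have hmono : p.nthReturn n a ≤ p.nthReturn (n + M) a :=
    Finset.sum_le_sum_of_subset_of_nonneg (Finset.range_mono (by omega)) fun i _ _ => by
      have := hp.four_lt_returnTime (hp.iterate_mem ha (n := i) fun k _ => h0 k) (h0 i)
      linarith
  obtain ⟨s2, s3⟩ := hs.sync hp ha hb hc hta hab n (fun i _ => h0 i) (by linarith)
  have key : ∀ i ≤ n, |p.returnMap^[i] a 0 - p.returnMap^[i] b 0| ≤ min δ ρ := by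
    intro i hi
    have ma := hp.iterate_mem ha (n := i) fun k _ => h0 k
    have mb := hp.iterate_mem hb (n := i) fun k hk => right_ne_zero_of_mul (s1 k (by omega)).ne'
    have := hp.contraction ma mb (n := M) fun k hk => by
      rw [← Function.iterate_add_apply, ← Function.iterate_add_apply]
      exact s1 _ (by omega)
    have h2 : 0 < √2 ^ M := by positivity
    refine le_of_mul_le_mul_left (this.trans hM.le) h2
  exact ⟨(key 0 (Nat.zero_le _)).trans (min_le_right _ _), s2, s3,
    hd b fun i hi => (key i hi.le).trans (min_le_left _ _)⟩

/-! ### The effect of the noise -/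

/-- The observations of the orbit started from `a` at the time `ta`, up to the time `K`, are
compatible with the orbit started from `b` at the time `tb`. -/
def Compatible (p : Params) (h ε : ℝ) (Z : ℕ → E3) (K : ℝ) (a : E3) (ta : ℝ) (b : E3) (tb : ℝ) :
    Prop :=
  ∀ i : ℕ, ta ≤ i * h → tb ≤ i * h → i * h ≤ K →
    p.orbit a (i * h - ta) + Z i - p.orbit b (i * h - tb) ∈ noiseCube ε

variable {Z : ℕ → E3}

theorem Compatible.close (hc : p.Compatible h ε Z K a ta b tb) (hZ : ∀ i, Z i ∈ noiseCube ε) :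
    p.Close h ε K a ta b tb := by
  intro i h1 h2 h3 j
  obtain ⟨c1, c2⟩ := hc i h1 h2 h3 j
  obtain ⟨z1, z2⟩ := hZ i j
  simp only [PiLp.sub_apply, PiLp.add_apply] at c1 c2
  rw [abs_le]
  constructor <;> linarith

theorem Compatible.shift_left (hc : p.Compatible h ε Z K a ta b tb) (hp : p.Admissible)
    (ha : a ∈ returnSquare) {n : ℕ} (h0 : ∀ i < n, p.returnMap^[i] a 0 ≠ 0) :
    p.Compatible h ε Z K (p.returnMap^[n] a) (ta + p.nthReturn n a) b tb := by
  intro i h1 h2 h3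
  have h4 : (0 : ℝ) ≤ 4 * n := by positivity
  have h5 := hp.four_mul_le_nthReturn ha h0
  rw [← sub_sub, ← hp.orbit_iterate ha h0 (by linarith)]
  exact hc i (by linarith) h2 h3

theorem Compatible.shift_right (hc : p.Compatible h ε Z K a ta b tb) (hp : p.Admissible)
    (hb : b ∈ returnSquare) {n : ℕ} (h0 : ∀ i < n, p.returnMap^[i] b 0 ≠ 0) :
    p.Compatible h ε Z K a ta (p.returnMap^[n] b) (tb + p.nthReturn n b) := by
  intro i h1 h2 h3
  have h4 : (0 : ℝ) ≤ 4 * n := by positivity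
  have h5 := hp.four_mul_le_nthReturn hb h0
  rw [← sub_sub, ← hp.orbit_iterate hb h0 (by linarith)]
  exact hc i h1 (by linarith) h3

/-- An observation time just after the `(n+1)`-st return. -/
noncomputable def tick (p : Params) (D h : ℝ) (a : E3) (ta : ℝ) (n : ℕ) : ℕ :=
  -- By the margin `2D` every matched orbit has also returned by then. The definition involves only
  -- the true orbit, so one almost sure event serves all candidates. The index `n + 1` makes the
  -- time nonnegative although `ta` may be negative.
  ⌈(ta + p.nthReturn (n + 1) a + 2 * D) / h⌉₊

theorem Small.tick_bounds (hs : p.Small D h ε) (hp : p.Admissible) (ha : a ∈ returnSquare)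
    (h0 : ∀ i, p.returnMap^[i] a 0 ≠ 0) (hta : -2 ≤ ta) (n : ℕ) :
    ta + p.nthReturn (n + 1) a + 2 * D ≤ p.tick D h a ta n * h ∧
      p.tick D h a ta n * h < ta + p.nthReturn (n + 1) a + 2 * D + h := by
  have hh := hs.h_pos
  have h1 := hp.four_mul_le_nthReturn ha (n := n + 1) fun i _ => h0 i
  have h2 : (0 : ℝ) ≤ n := n.cast_nonneg
  push_cast at h1
  have h3 : 0 ≤ ta + p.nthReturn (n + 1) a + 2 * D := by linarith [hs.D_pos]
  constructor
  · rw [← div_le_iff₀ hh]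
    exact Nat.le_ceil _
  · have := Nat.ceil_lt_add_one (div_nonneg h3 hh.le)
    rw [← lt_div_iff₀ hh, add_div _ h, div_self hh.ne']
    exact this

theorem Small.tick_injective (hs : p.Small D h ε) (hp : p.Admissible) (ha : a ∈ returnSquare)
    (h0 : ∀ i, p.returnMap^[i] a 0 ≠ 0) (hta : -2 ≤ ta) :
    Function.Injective (p.tick D h a ta) := by
  refine (strictMono_nat_of_lt_succ fun n => ?_).injective
  have h1 := (hs.tick_bounds hp ha h0 hta n).2
  have h2 := (hs.tick_bounds hp ha h0 hta (n + 1)).1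
  have h3 := hp.four_lt_returnTime (hp.iterate_mem ha (n := n + 1) fun i _ => h0 i) (h0 (n + 1))
  rw [nthReturn_succ (n + 1)] at h2
  have h4 : (p.tick D h a ta n : ℝ) * h < p.tick D h a ta (n + 1) * h := by
    linarith [hs.h_le, hs.D_le]
  exact_mod_cast lt_of_mul_lt_mul_right h4 hs.h_pos.le

/-- The third coordinate of the noise at the times `t n` comes close to both of its bounds. -/
def NoiseExtreme (ε : ℝ) (Z : ℕ → E3) (t : ℕ → ℕ) : Prop :=
  ∀ c > 0, (∃ n, Z (t n) 2 < -ε + c) ∧ ∃ n, ε - c < Z (t n) 2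

/-- Here `s` and `s'` are the ages of the two orbits since their matched returns. Both are in the
linear phase, so the third coordinate depends on the age alone. -/
theorem Small.compatible_tick (hs : p.Small D h ε) (hp : p.Admissible) (ha : a ∈ returnSquare)
    (hb : b ∈ returnSquare) (h0 : ∀ i, p.returnMap^[i] a 0 ≠ 0) (hta : -2 ≤ ta) (n : ℕ)
    (h0b : ∀ i < n + 1, p.returnMap^[i] b 0 ≠ 0)
    (hab : |ta + p.nthReturn (n + 1) a - (tb + p.nthReturn (n + 1) b)| ≤ 2 * D)
    (hc : p.Compatible h ε Z K a ta b tb) (hK : ta + p.nthReturn (n + 1) a + 1 ≤ K) :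
    ∃ s s', s ≤ 1 ∧ s' ≤ 1 ∧
      s - s' = tb + p.nthReturn (n + 1) b - (ta + p.nthReturn (n + 1) a) ∧
      |Real.exp (-p.lam3 * s) + Z (p.tick D h a ta n) 2 - Real.exp (-p.lam3 * s')| ≤ ε := by
  have ma := hp.iterate_mem ha (n := n + 1) fun i _ => h0 i
  have mb := hp.iterate_mem hb h0b
  obtain ⟨t1, t2⟩ := hs.tick_bounds hp ha h0 hta n
  have h1 := hs.D_pos
  have h2 := hs.D_le
  have h3 := hs.h_le
  rw [abs_le] at hab
  have hc' := (hc.shift_left hp ha (n := n + 1) fun i _ => h0 i).shift_right hp hb h0b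
    (p.tick D h a ta n) (by linarith) (by linarith) (by linarith) 2
  rw [PiLp.sub_apply, PiLp.add_apply, hs.orbit_short hp ma (by linarith),
    hs.orbit_short hp mb (by linarith), linFlow_two, linFlow_two, ma.2.2, mb.2.2, one_mul, one_mul]
    at hc'
  exact ⟨_, _, by linarith, by linarith, by ring, abs_le.2 hc'⟩

/-- Up to age `1` the height `exp (-λ₃ s)` decreases at rate at least `λ₃ exp (-λ₃)`. -/
theorem Admissible.exp_gap (hp : p.Admissible) {s s' ρ : ℝ} (hs : s ≤ 1) (hss : s' ≤ s - ρ)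
    (hρ : 0 ≤ ρ) :
    Real.exp (-p.lam3) * (p.lam3 * ρ) ≤ Real.exp (-p.lam3 * s') - Real.exp (-p.lam3 * s) := by
  have l3 := hp.lam3_pos
  have e1 : Real.exp (-p.lam3) ≤ Real.exp (-p.lam3 * s) := Real.exp_le_exp.2 (by nlinarith)
  have e2 : Real.exp (-p.lam3 * s) * Real.exp (p.lam3 * ρ) ≤ Real.exp (-p.lam3 * s') := by
    rw [← Real.exp_add]
    exact Real.exp_le_exp.2 (by nlinarith)
  have e3 := Real.add_one_le_exp (p.lam3 * ρ)
  have e4 : 0 ≤ p.lam3 * ρ := by positivity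
  nlinarith [Real.exp_pos (-p.lam3 * s), mul_le_mul_of_nonneg_right e1 e4]

theorem Small.noise_limit (hs : p.Small D h ε) (hp : p.Admissible) (ha : a ∈ returnSquare)
    (h0 : ∀ i, p.returnMap^[i] a 0 ≠ 0) (hZ : ∀ i, Z i ∈ noiseCube ε)
    (hta : -2 ≤ ta) (hN : NoiseExtreme ε Z (p.tick D h a ta)) {ρ : ℝ} (hρ : 0 < ρ) :
    ∃ K₀, ∀ K ≥ K₀, ∀ b ∈ returnSquare, ∀ tb, -1 ≤ tb → |ta - tb| ≤ 2 * D →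
      p.Compatible h ε Z K a ta b tb → |a 0 - b 0| ≤ ρ ∧ |ta - tb| ≤ ρ := by
  -- The threshold is the displacement that `exp_gap` gives for a shift `ρ/2`; the other `ρ/2`
  -- absorbs the difference of the return times. Noise near `-ε` excludes that the first orbit is
  -- older, noise near `ε` that it is younger.
  obtain ⟨⟨n, hn⟩, m, hm⟩ := hN (Real.exp (-p.lam3) * (p.lam3 * (ρ / 2)))
    (by have := hp.lam3_pos; positivity)
  obtain ⟨K₁, hK₁⟩ := hs.sync_limit hp ha h0 ta (n + 1) (half_pos hρ)
  obtain ⟨K₂, hK₂⟩ := hs.sync_limit hp ha h0 ta (m + 1) (half_pos hρ)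
  refine ⟨max (max K₁ K₂) (max (ta + p.nthReturn (n + 1) a + 1) (ta + p.nthReturn (m + 1) a + 1)),
    fun K hK b hb tb htb hab hc => ?_⟩
  simp only [ge_iff_le, max_le_iff] at hK
  obtain ⟨⟨k1, k2⟩, k3, k4⟩ := hK
  obtain ⟨q1, q2, q3, q4⟩ := hK₁ K k1 b hb tb htb hab (hc.close hZ)
  obtain ⟨-, r2, r3, r4⟩ := hK₂ K k2 b hb tb htb hab (hc.close hZ)
  obtain ⟨s, s', s1, s2, s3, s4⟩ := hs.compatible_tick hp ha hb h0 hta n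
    (fun i hi => right_ne_zero_of_mul (q2 i hi).ne') q3 hc k3
  obtain ⟨t, t', t1, t2, t3, t4⟩ := hs.compatible_tick hp ha hb h0 hta m
    (fun i hi => right_ne_zero_of_mul (r2 i hi).ne') r3 hc k4
  rw [abs_le] at q4 r4 s4 t4
  refine ⟨q1.trans (by linarith), ?_⟩
  rw [abs_le]
  constructor
  · by_contra hcon
    have := hp.exp_gap s1 (show s' ≤ s - ρ / 2 by linarith) (by linarith)
    linarith
  · by_contra hcon
    have := hp.exp_gap t2 (show t ≤ t' - ρ / 2 by linarith) (by linarith)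
    linarith

end Params

end GeoLorenz

namespace GeoLorenz

namespace Params

variable {p : Params} {D h ε : ℝ} {a b : E3} {K ta tb : ℝ} {Z : ℕ → E3}

/-! ### Continuity of the excursions in the leaf coordinate and the time -/

theorem Admissible.excursion_rot (hp : p.Admissible) (ha : a ∈ returnSquare) (a0 : a 0 ≠ 0) {t : ℝ}
    (ht : p.timeToSigma a < t) :
    p.excursion a t = p.rotFlow (t - p.timeToSigma a)
      !₂[if 0 < a 0 then 1 else -1, p.exitPoint a 1, |a 0| ^ p.alpha] := by
  rw [excursion, if_neg (by rintro (h | h); exacts [a0 h, h.not_gt ht])]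
  congr 1
  ext j
  fin_cases j
  · simp only [Fin.zero_eta, (exitPoint_bounds hp ha a0).1, Matrix.cons_val_zero]
    split_ifs with h
    · rw [abs_of_pos h, div_self a0]
    · rw [abs_of_neg (lt_of_le_of_ne (not_lt.1 h) a0), div_neg, div_self a0]
  · simp
  · simp [hp.exitPoint_two ha a0]

theorem Admissible.excursion_rot_zero (hp : p.Admissible) (ha : a ∈ returnSquare) (a0 : a 0 ≠ 0)
    {t : ℝ} (ht : p.timeToSigma a < t) :
    p.excursion a t 0 = (if 0 < a 0 then 1 else -1) *
      (1 + (1 - |a 0| ^ p.alpha + (1 / 2 - (p.theta - 1) * |a 0| ^ p.alpha) *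
        ((t - p.timeToSigma a) / (3 / 2 * Real.pi))) * Real.sin (t - p.timeToSigma a)) := by
  rw [hp.excursion_rot ha a0 ht, rotFlow]
  by_cases h : 0 < a 0
  · simp [h, rotRadius]
  · have h1 : ¬ (0 : ℝ) < -1 := by norm_num
    simp [h, h1, rotRadius]
    ring

theorem Admissible.excursion_rot_two (hp : p.Admissible) (ha : a ∈ returnSquare) (a0 : a 0 ≠ 0)
    {t : ℝ} (ht : p.timeToSigma a < t) :
    p.excursion a t 2 = 1 - (1 - |a 0| ^ p.alpha + (1 / 2 - (p.theta - 1) * |a 0| ^ p.alpha) *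
        ((t - p.timeToSigma a) / (3 / 2 * Real.pi))) * Real.cos (t - p.timeToSigma a) := by
  rw [hp.excursion_rot ha a0 ht, rotFlow]
  split_ifs <;> simp [rotRadius]

/-- Neither coordinate involves the second coordinate of the starting point, so closeness of `a 1`
and `b 1` is not needed. At the excluded time the path switches from the linear to the rotation
formula. -/
theorem Admissible.exists_excursion_close (hp : p.Admissible) (ha : a ∈ returnSquare)
    (a0 : a 0 ≠ 0) {t : ℝ} (ht : t ≠ p.timeToSigma a) {ρ : ℝ} (hρ : 0 < ρ) :
    ∃ δ > 0, ∀ b ∈ returnSquare, ∀ s, |a 0 - b 0| ≤ δ → |t - s| ≤ δ →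
      |p.excursion a t 0 - p.excursion b s 0| ≤ ρ ∧
        |p.excursion a t 2 - p.excursion b s 2| ≤ ρ := by
  have ev : ∀ᶠ z : ℝ × ℝ in 𝓝 (a 0, t), ∀ b ∈ returnSquare, b 0 = z.1 →
      |p.excursion a t 0 - p.excursion b z.2 0| ≤ ρ ∧
        |p.excursion a t 2 - p.excursion b z.2 2| ≤ ρ := by
    have hx : |a 0| ≠ 0 := abs_ne_zero.2 a0
    have hx' : 1 / |a 0| ≠ 0 := by positivity
    have hT : ContinuousAt (fun z : ℝ × ℝ => 1 / p.lam1 * Real.log (1 / |z.1|)) (a 0, t) := by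
      fun_prop (disch := assumption)
    have hpow : ContinuousAt (fun z : ℝ × ℝ => |z.1| ^ p.alpha) (a 0, t) :=
      ContinuousAt.rpow_const (by fun_prop) (Or.inl hx)
    have aux : ∀ {f : ℝ × ℝ → ℝ}, ContinuousAt f (a 0, t) →
        ∀ᶠ z in 𝓝 (a 0, t), |f (a 0, t) - f z| ≤ ρ := by
      intro f hf
      filter_upwards [Metric.continuousAt_iff'.1 hf ρ hρ] with z hz
      rw [Real.dist_eq, abs_sub_comm] at hz
      exact hz.le
    have hfst : ContinuousAt (fun z : ℝ × ℝ => z.1) (a 0, t) := continuousAt_fst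
    have hsnd : ContinuousAt (fun z : ℝ × ℝ => z.2) (a 0, t) := continuousAt_snd
    rcases lt_or_gt_of_ne ht with hlt | hgt
    · filter_upwards [aux (f := fun z => z.1 * Real.exp (p.lam1 * z.2)) (by fun_prop),
        aux (f := fun z => 1 * Real.exp (-p.lam3 * z.2)) (by fun_prop),
        hsnd.eventually_lt hT hlt] with z h1 h2 h3 b hb hbz
      have e1 : z.2 ≤ p.timeToSigma b := by rw [timeToSigma, hbz]; exact h3.le
      rw [excursion_eq_linFlow (Or.inr hlt.le), excursion_eq_linFlow (Or.inr e1), linFlow_zero,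
        linFlow_zero, linFlow_two, linFlow_two, ha.2.2, hb.2.2, hbz]
      exact ⟨h1, h2⟩
    · have hr : ContinuousAt (fun z : ℝ × ℝ => 1 - |z.1| ^ p.alpha +
          (1 / 2 - (p.theta - 1) * |z.1| ^ p.alpha) *
          ((z.2 - 1 / p.lam1 * Real.log (1 / |z.1|)) / (3 / 2 * Real.pi))) (a 0, t) :=
        (continuousAt_const.sub hpow).add ((continuousAt_const.sub (continuousAt_const.mul hpow)).mul
          ((hsnd.sub hT).div_const _))
      have hs : ContinuousAt (fun z : ℝ × ℝ =>
          Real.sin (z.2 - 1 / p.lam1 * Real.log (1 / |z.1|))) (a 0, t) :=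
        Real.continuous_sin.continuousAt.comp (hsnd.sub hT)
      have hc : ContinuousAt (fun z : ℝ × ℝ =>
          Real.cos (z.2 - 1 / p.lam1 * Real.log (1 / |z.1|))) (a 0, t) :=
        Real.continuous_cos.continuousAt.comp (hsnd.sub hT)
      have hsgn : ∀ᶠ z : ℝ × ℝ in 𝓝 (a 0, t), 0 < a 0 * z.1 :=
        continuousAt_const.eventually_lt (f := fun _ : ℝ × ℝ => (0 : ℝ))
          (g := fun z : ℝ × ℝ => a 0 * z.1) (by fun_prop) (mul_self_pos.2 a0)
      have hone : ContinuousAt (fun _ : ℝ × ℝ => (1 : ℝ)) (a 0, t) := continuousAt_const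
      filter_upwards [aux (hone.add (hr.mul hs)), aux (hone.sub (hr.mul hc)), hsgn,
        hT.eventually_lt hsnd hgt] with z h1 h2 h3 h4 b hb hbz
      have e1 : p.timeToSigma b < z.2 := by rw [timeToSigma, hbz]; exact h4
      rw [← hbz] at h3
      have b0 : b 0 ≠ 0 := right_ne_zero_of_mul h3.ne'
      have hiff : 0 < b 0 ↔ 0 < a 0 :=
        ⟨fun h => pos_of_mul_pos_left h3 h.le, fun h => pos_of_mul_pos_right h3 h.le⟩
      rw [hp.excursion_rot_zero ha a0 hgt, hp.excursion_rot_zero hb b0 e1,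
        hp.excursion_rot_two ha a0 hgt, hp.excursion_rot_two hb b0 e1]
      simp only [hiff, ← mul_sub, abs_mul]
      rw [show |(if 0 < a 0 then 1 else -1 : ℝ)| = 1 by split_ifs <;> simp, one_mul]
      simp only [timeToSigma, hbz]
      exact ⟨h1, h2⟩
  obtain ⟨δ, hδ, hd⟩ := Metric.nhds_basis_closedBall.eventually_iff.1 ev
  refine ⟨δ, hδ, fun b hb s h1 h2 => hd (x := (b 0, s)) ?_ b hb rfl⟩
  rw [Metric.mem_closedBall, Prod.dist_eq, Real.dist_eq, Real.dist_eq, abs_sub_comm,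
    abs_sub_comm s]
  exact max_le h1 h2

theorem nthReturn_one (a : E3) : p.nthReturn 1 a = p.returnTime a := by
  simp [nthReturn]

/-- A point that is compatible with the observations for a long time is close to the leaf through
the true initial point. -/
theorem Small.compatible_limit (hs : p.Small D h ε) (hp : p.Admissible) (ha : a ∈ returnSquare)
    {t : ℝ} (hat : p.BeforeReturn a t) (ht : 0 < t) (htT : t ≠ p.timeToSigma a)
    (h0 : ∀ i, p.returnMap^[i] a 0 ≠ 0) (hZ : ∀ i, Z i ∈ noiseCube ε)
    (hN : -2 ≤ -t → NoiseExtreme ε Z (p.tick D h a (-t)))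
    (hN' : NoiseExtreme ε Z (p.tick D h (p.returnMap a) (-t + p.returnTime a)))
    {ρ : ℝ} (hρ : 0 < ρ) :
    ∃ K₀, ∀ K ≥ K₀, ∀ b ∈ returnSquare, ∀ s, p.BeforeReturn b s →
      p.Compatible h ε Z K a (-t) b (-s) →
      |p.excursion a t 0 - p.excursion b s 0| ≤ ρ ∧
        |p.excursion a t 2 - p.excursion b s 2| ≤ ρ := by
  have a0 : a 0 ≠ 0 := h0 0
  have hD := hs.D_pos
  have hD1 := hs.D_le
  have ha' := returnMap_mem hp ha a0
  have hta : 0 < -t + p.returnTime a := by linarith [hat.2 a0]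
  obtain ⟨δ, hδ, hd⟩ := hp.exists_excursion_close ha a0 htT hρ
  obtain ⟨δ', hδ', hd'⟩ := exists_returnTime_close (p := p) a0 (half_pos hδ)
  -- The starting times need not be matched, so the limit is taken from the first return of the true
  -- orbit onwards. The last entry of the minimum serves to refute a matching with the start of `b`.
  obtain ⟨K₁, hK₁⟩ := hs.noise_limit hp ha' (fun i => by
    rw [← Function.iterate_succ_apply]; exact h0 _) hZ (by linarith) hN'
    (ρ := min (min (δ / 2) δ') ((-t + p.returnTime a) / 2)) (by positivity)
  obtain ⟨K₂, hK₂⟩ : ∃ K₂, -2 ≤ -t → ∀ K ≥ K₂, ∀ b ∈ returnSquare, ∀ tb, -1 ≤ tb →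
      |-t - tb| ≤ 2 * D → p.Compatible h ε Z K a (-t) b tb → |-t - tb| ≤ t / 2 := by
    by_cases h2 : -2 ≤ -t
    · obtain ⟨K₂, hK₂⟩ := hs.noise_limit hp ha h0 hZ h2 (hN h2) (half_pos ht)
      exact ⟨K₂, fun _ K hK b hb tb h1 h2 h3 => (hK₂ K hK b hb tb h1 h2 h3).2⟩
    · exact ⟨0, fun h => absurd h h2⟩
  refine ⟨max (max K₁ K₂) (-t + p.returnTime a + 1), fun K hK b hb s hbs hc => ?_⟩
  simp only [ge_iff_le, max_le_iff] at hK
  obtain ⟨⟨k1, k2⟩, k3⟩ := hK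
  have hsb : b 0 ≠ 0 → 0 < -s + p.returnTime b := fun h => by linarith [hbs.2 h]
  have one : ∀ {c : E3}, c 0 ≠ 0 → ∀ i < 1, p.returnMap^[i] c 0 ≠ 0 := by
    intro c hc i hi
    obtain rfl : i = 0 := by omega
    exact hc
  have hca := hc.shift_left hp ha (one a0)
  rw [nthReturn_one, Function.iterate_one] at hca
  rcases hs.match_return hp ha hb (hc.close hZ) a0 hta.le (by linarith) (fun h => (hsb h).le)
    (by linarith [hbs.1]) (fun h => by linarith [hsb h]) with ⟨b0, hm⟩ | ⟨b0, hm⟩ | hm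
  · have hcab := hca.shift_right hp hb (one b0)
    rw [nthReturn_one, Function.iterate_one] at hcab
    have hb' := returnMap_mem hp hb b0
    obtain ⟨q1, q2⟩ := hK₁ K k1 _ hb' _ (by linarith [hsb b0]) hm hcab
    simp only [le_min_iff] at q1 q2
    have side := hs.same_side hp ha hb a0 b0 (hcab.close hZ) hm hta.le (by linarith)
    have hexp := hp.lorenzMap_expanding ha.1 hb.1 side
    rw [← hp.returnMap_zero ha a0, ← hp.returnMap_zero hb b0] at hexp
    -- Expansion carries closeness after the return back to closeness before it.
    have hle : |a 0 - b 0| ≤ |p.returnMap a 0 - p.returnMap b 0| := by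
      nlinarith [Real.one_lt_sqrt_two, abs_nonneg (a 0 - b 0)]
    have hT := abs_le.1 (hd' a b rfl (hle.trans q1.1.2))
    have hq := abs_le.1 q2.1.1
    refine hd b hb s (by linarith [q1.1.1]) ?_
    rw [abs_le]
    constructor <;> linarith
  -- Here `u` has just left `S` and `v` is about to return: the matched times `-t < 0` and `-s +
  -- p.returnTime b > 0` would be within `t/2`. The last case is the mirror image.
  · exfalso
    have hcb := hc.shift_right hp hb (one b0)
    rw [nthReturn_one, Function.iterate_one] at hcb
    have hm' := abs_le.1 hm
    have := hsb b0
    have := abs_le.1 (hK₂ (by linarith) K k2 _ (returnMap_mem hp hb b0) _ (by linarith) hm hcb)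
    linarith
  · exfalso
    have hm' := abs_le.1 hm
    have := (hK₁ K k1 b hb _ (by linarith) hm hca).2
    simp only [le_min_iff] at this
    have := abs_le.1 this.2
    linarith [hbs.1]

end Params

end GeoLorenz

namespace GeoLorenz

/-! ### Almost sure properties of the noise -/

theorem measurableSet_noiseCube (ε : ℝ) : MeasurableSet (noiseCube ε) := by
  have : noiseCube ε = ⋂ j, (fun z : E3 => z j) ⁻¹' Set.Icc (-ε) ε := by
    ext z
    simp [noiseCube]
  rw [this]
  exact MeasurableSet.iInter fun j => (by fun_prop : Measurable fun z : E3 => z j) measurableSet_Icc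

theorem isOpen_openCube (ε : ℝ) : IsOpen {z : E3 | ∀ j, z j ∈ Set.Ioo (-ε) ε} := by
  simp only [Set.ofPred_forall]
  exact isOpen_iInter_of_finite fun j =>
    isOpen_Ioo.preimage (by fun_prop : Continuous fun z : E3 => z j)

theorem volume_noiseCube_inter_ne_zero {ε : ℝ} {A : Set E3} (hA : IsOpen A) {z : E3}
    (hz : ∀ j, z j ∈ Set.Ioo (-ε) ε) (hzA : z ∈ A) : volume (noiseCube ε ∩ A) ≠ 0 := by
  have h1 := ((isOpen_openCube ε).inter hA).measure_pos volume ⟨z, hz, hzA⟩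
  refine (h1.trans_le (measure_mono ?_)).ne'
  rintro w ⟨hw, hwA⟩
  exact ⟨fun j => Set.Ioo_subset_Icc_self (hw j), hwA⟩

theorem volume_noiseCube_ne_top (ε : ℝ) : volume (noiseCube ε) ≠ ⊤ := by
  refine (Bornology.IsBounded.measure_lt_top ?_).ne
  rw [Metric.isBounded_iff_subset_closedBall 0]
  refine ⟨3 * |ε|, fun z hz => ?_⟩
  rw [mem_closedBall_zero_iff, EuclideanSpace.norm_eq]
  apply Real.sqrt_le_iff.2 ⟨by positivity, ?_⟩
  have h1 : ∀ j, ‖z j‖ ^ 2 ≤ |ε| ^ 2 := fun j => by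
    rw [Real.norm_eq_abs, sq_abs, sq_abs]
    have := hz j
    exact sq_le_sq' this.1 this.2
  rw [Fin.sum_univ_three]
  nlinarith [h1 0, h1 1, h1 2, sq_nonneg |ε|]

theorem ae_forall_mem_noiseCube {Ω : Type*} [MeasurableSpace Ω] {P : Measure Ω} {Z : ℕ → Ω → E3}
    {ε : ℝ} (hε : 0 < ε)
    (hu : ∀ i, pdf.IsUniform (Z i) (noiseCube ε) P volume) :
    ∀ᵐ ω ∂P, ∀ i, Z i ω ∈ noiseCube ε := by
  refine ae_all_iff.2 fun i => ?_
  have hc : volume (noiseCube ε) ≠ 0 := by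
    have := volume_noiseCube_inter_ne_zero (ε := ε) isOpen_univ (z := 0) (by simp [hε])
      (Set.mem_univ _)
    rwa [Set.inter_univ] at this
  have h1 := (hu i).measure_preimage hc (volume_noiseCube_ne_top ε)
    (measurableSet_noiseCube ε).compl
  rw [Set.inter_compl_self, measure_empty, ENNReal.zero_div] at h1
  exact h1

section Noise

variable {Ω : Type*} [MeasurableSpace Ω] {P : Measure Ω} [IsProbabilityMeasure P]
  {Z : ℕ → Ω → E3} {ε : ℝ}

/-- Second Borel–Cantelli lemma: along distinct indices the events are independent with the same
positive probability. -/
theorem ae_exists_mem (hm : ∀ i, Measurable (Z i)) (hi : iIndepFun Z P)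
    (hu : ∀ i, pdf.IsUniform (Z i) (noiseCube ε) P volume) {A : Set E3} (hA : IsOpen A) {z : E3}
    (hz : ∀ j, z j ∈ Set.Ioo (-ε) ε) (hzA : z ∈ A) {t : ℕ → ℕ} (ht : Function.Injective t) :
    ∀ᵐ ω ∂P, ∃ n, Z (t n) ω ∈ A := by
  have hc := volume_noiseCube_inter_ne_zero hA hz hzA
  have hmeas : ∀ n, MeasurableSet (Z (t n) ⁻¹' A) := fun n => hm _ hA.measurableSet
  have hind : iIndepSet (fun n => Z (t n) ⁻¹' A) P :=
    (iIndepSet_iff_meas_biInter hmeas).2 fun s =>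
      (hi.precomp ht).meas_biInter fun n _ => ⟨A, hA.measurableSet, rfl⟩
  have hP : ∀ n, P (Z (t n) ⁻¹' A) = volume (noiseCube ε ∩ A) / volume (noiseCube ε) := fun n =>
    (hu _).measure_preimage
      (fun h => hc (measure_mono_null Set.inter_subset_left h)) (volume_noiseCube_ne_top ε)
      hA.measurableSet
  have hlim := measure_limsup_eq_one hmeas hind (by
    simp only [hP]
    exact ENNReal.tsum_const_eq_top_of_ne_zero (ENNReal.div_ne_zero.2
      ⟨hc, volume_noiseCube_ne_top ε⟩))
  rw [← mem_ae_iff_prob_eq_one (MeasurableSet.measurableSet_limsup hmeas)] at hlim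
  filter_upwards [hlim] with ω hω
  rw [Filter.mem_limsup_iff_frequently_mem] at hω
  exact hω.exists

theorem ae_noiseExtreme (hε : 0 < ε) (hm : ∀ i, Measurable (Z i)) (hi : iIndepFun Z P)
    (hu : ∀ i, pdf.IsUniform (Z i) (noiseCube ε) P volume) {t : ℕ → ℕ}
    (ht : Function.Injective t) :
    ∀ᵐ ω ∂P, Params.NoiseExtreme ε (fun i => Z i ω) t := by
  have key : ∀ᵐ ω ∂P, ∀ m : ℕ, (∃ n, Z (t n) ω ∈ {z : E3 | z 2 < -ε + 1 / ((m : ℝ) + 1)}) ∧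
      ∃ n, Z (t n) ω ∈ {z : E3 | ε - 1 / ((m : ℝ) + 1) < z 2} := by
    refine ae_all_iff.2 fun m => ?_
    have he : 0 < 1 / ((m : ℝ) + 1) := by positivity
    generalize 1 / ((m : ℝ) + 1) = e at he ⊢
    obtain ⟨d, hd, hd1, hd2⟩ : ∃ d, 0 < d ∧ d ≤ ε ∧ d < e :=
      ⟨min ε (e / 2), by positivity, min_le_left _ _, (min_le_right _ _).trans_lt (half_lt_self he)⟩
    refine (ae_exists_mem hm hi hu ?_ (z := !₂[0, 0, -ε + d]) ?_ ?_ ht).and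
      (ae_exists_mem hm hi hu ?_ (z := !₂[0, 0, ε - d]) ?_ ?_ ht)
    · exact isOpen_lt (by fun_prop) (by fun_prop)
    · intro j
      fin_cases j <;> (simp [hε, hd]; try linarith)
    · simp
      linarith
    · exact isOpen_lt (by fun_prop) (by fun_prop)
    · intro j
      fin_cases j <;> (simp [hε, hd]; try linarith)
    · simp
      linarith
  filter_upwards [key] with ω hω c hc
  obtain ⟨m, hm⟩ := exists_nat_one_div_lt hc
  obtain ⟨⟨n, hn⟩, n', hn'⟩ := hω m
  exact ⟨⟨n, lt_trans hn (by linarith)⟩, n', lt_trans (by linarith) hn'⟩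

end Noise

/-! ### Exceptional initial points -/

theorem volume_coord_mem_countable (j : Fin 3) {B : Set ℝ} (hB : B.Countable) :
    volume {w : E3 | w j ∈ B} = 0 :=
  (PiLp.volume_preserving_ofLp (Fin 3)).quasiMeasurePreserving.preimage_null
    (Measure.pi_eval_preimage_null (fun _ : Fin 3 => (volume : Measure ℝ)) (i := j)
      (hB.measure_zero _))

namespace Params

variable {p : Params} {a : E3}

/-- The leaf coordinates of the points of `S` that reach the stable manifold of the origin after
`n` returns. -/
noncomputable def deadCoords (p : Params) : ℕ → Set ℝ
  | 0 => {0}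
  | n + 1 => {x | x ≠ 0 ∧ |x| ≤ 1 / 2 ∧ p.lorenzMap x ∈ deadCoords p n}

/-- Expansion makes the return map injective on each side of `0`, so preimages of countable sets are
countable. -/
theorem Admissible.countable_deadCoords (hp : p.Admissible) (n : ℕ) :
    (p.deadCoords n).Countable := by
  induction n with
  | zero => exact Set.countable_singleton 0
  | succ n ih =>
    have half : ∀ s : Set ℝ, s ⊆ p.deadCoords (n + 1) → (∀ x ∈ s, ∀ y ∈ s, 0 < x * y) →
        s.Countable := by
      intro s hs hpos
      refine Set.countable_of_injective_of_countable_image (f := p.lorenzMap) ?_ (ih.mono ?_)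
      · intro x hx y hy hxy
        have h1 := hp.lorenzMap_expanding (hs hx).2.1 (hs hy).2.1 (hpos x hx y hy)
        rw [hxy, sub_self, abs_zero] at h1
        have h2 : |x - y| ≤ 0 := by
          by_contra hcon
          have : 0 < √2 * |x - y| := mul_pos (by positivity) (not_le.1 hcon)
          linarith
        exact sub_eq_zero.1 (abs_nonpos_iff.1 h2)
      · rintro _ ⟨x, hx, rfl⟩
        exact (hs hx).2.2
    refine ((half (p.deadCoords (n + 1) ∩ Set.Ioi 0) Set.inter_subset_left ?_).union
      (half (p.deadCoords (n + 1) ∩ Set.Iio 0) Set.inter_subset_left ?_)).mono ?_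
    · exact fun x hx y hy => mul_pos hx.2 hy.2
    · exact fun x hx y hy => mul_pos_of_neg_of_neg hx.2 hy.2
    · intro x hx
      rcases lt_or_gt_of_ne hx.1 with h | h
      exacts [Or.inr ⟨hx, h⟩, Or.inl ⟨hx, h⟩]

theorem Admissible.mem_deadCoords (hp : p.Admissible) (n : ℕ) (ha : a ∈ returnSquare)
    (h0 : ∀ i < n, p.returnMap^[i] a 0 ≠ 0) (hn : p.returnMap^[n] a 0 = 0) :
    a 0 ∈ p.deadCoords n := by
  induction n generalizing a with
  | zero => exact hn
  | succ n ih =>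
    have a0 : a 0 ≠ 0 := h0 0 (by omega)
    refine ⟨a0, ha.1, ?_⟩
    rw [← hp.returnMap_zero ha a0]
    exact ih (returnMap_mem hp ha a0) (fun i hi => h0 (i + 1) (by omega)) hn

theorem Admissible.iterate_ne_zero (hp : p.Admissible) (ha : a ∈ returnSquare)
    (h : a 0 ∉ ⋃ n, p.deadCoords n) (n : ℕ) : p.returnMap^[n] a 0 ≠ 0 := by
  induction n using Nat.strong_induction_on with
  | _ n ih => exact fun hn => h (Set.mem_iUnion.2 ⟨n, hp.mem_deadCoords n ha ih hn⟩)

theorem differentiable_linFlow_param :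
    Differentiable ℝ fun w : E3 => p.linFlow (w 2) !₂[w 0, w 1, 1] := by
  rw [differentiable_euclidean]
  intro j
  fin_cases j <;> simp [linFlow] <;> fun_prop

theorem differentiable_rotFlow_param (c : ℝ) :
    Differentiable ℝ fun w : E3 => p.rotFlow (w 2) !₂[c, w 1, w 0] := by
  rw [differentiable_euclidean]
  intro j
  by_cases hc : 0 < c <;> fin_cases j <;> simp [rotFlow, rotRadius, hc] <;> fun_prop

/-- The exceptional points lie in images of countable unions of planes under differentiable maps of
`ℝ³`, which preserve null sets. In the rotation part the parameter is the exit height `|x| ^ α`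
instead of `x`, as the flow is affine in the height. -/
theorem Admissible.ae_iterate_ne_zero (hp : p.Admissible) :
    ∀ᵐ u ∂(volume : Measure E3), ∀ a t, p.IsOrigin u (a, t) → ∀ n, p.returnMap^[n] a 0 ≠ 0 := by
  set B : Set ℝ := ⋃ n, p.deadCoords n
  have hBc : B.Countable := Set.countable_iUnion hp.countable_deadCoords
  set N : Set E3 := {w | w 0 ∈ B}
  set N' : Set E3 := {w | w 0 ∈ (fun x => |x| ^ p.alpha) '' B}
  have hN : volume N = 0 := volume_coord_mem_countable 0 hBc
  have hN' : volume N' = 0 := volume_coord_mem_countable 0 (hBc.image _)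
  have h1 := addHaar_image_eq_zero_of_differentiableOn_of_addHaar_eq_zero volume
    (differentiable_linFlow_param (p := p)).differentiableOn hN
  have h2 := fun c => addHaar_image_eq_zero_of_differentiableOn_of_addHaar_eq_zero volume
    (differentiable_rotFlow_param (p := p) c).differentiableOn hN'
  rw [← compl_mem_ae_iff] at h1
  have h2' := fun c => compl_mem_ae_iff.2 (h2 c)
  filter_upwards [h1, h2' 1, h2' (-1)] with u u1 u2 u3 a t ⟨ha, _, hu⟩
  refine hp.iterate_ne_zero ha fun hmem => ?_
  simp only at ha hu
  by_cases hlin : a 0 = 0 ∨ t ≤ p.timeToSigma a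
  · rw [excursion_eq_linFlow hlin] at hu
    refine u1 ⟨!₂[a 0, a 1, t], hmem, ?_⟩
    rw [← hu]
    simp only [Matrix.cons_val]
    congr 1
    ext j
    fin_cases j <;> simp [ha.2.2]
  · push Not at hlin
    rw [hp.excursion_rot ha hlin.1 hlin.2] at hu
    have hm : !₂[(|a 0| ^ p.alpha), p.exitPoint a 1, t - p.timeToSigma a] ∈ N' := ⟨a 0, hmem, rfl⟩
    split_ifs at hu
    · exact u2 ⟨_, hm, by rw [← hu]; rfl⟩
    · exact u3 ⟨_, hm, by rw [← hu]; rfl⟩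

/-! ### The support of the smoother and the distance to the leaf -/

theorem isOrigin_origin {v : E3} (hv : v ∈ p.stateSpace) : p.IsOrigin v (p.origin v) :=
  Classical.epsilon_spec hv

theorem compatible_of_mem_smootherSupport {h ε : ℝ} {q : E3 → ℝ} {k : ℕ} {Z : ℕ → E3} {u v : E3}
    (hv : v ∈ p.smootherSupport h ε q k fun i => p.flow (i * h) u + Z i) (hh : 0 < h) :
    v ∈ p.stateSpace ∧ p.Compatible h ε Z (k * h) (p.origin u).1 (-(p.origin u).2)
      (p.origin v).1 (-(p.origin v).2) := by
  have hv1 : v ∈ p.stateSpace := by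
    by_contra hcon
    exact hv (Set.indicator_of_notMem hcon _)
  refine ⟨hv1, fun i _ _ hi => ?_⟩
  have hw : p.smootherWeight h ε q k (fun i => p.flow (i * h) u + Z i) v ≠ 0 := by
    intro hcon
    apply hv
    rw [smootherDensity, Set.indicator_of_mem hv1, hcon, zero_div]
  have hik : i ≤ k := by exact_mod_cast le_of_mul_le_mul_right hi hh
  have h1 := Finset.prod_ne_zero_iff.1 (left_ne_zero_of_mul hw) i
    (Finset.mem_range.2 (Nat.lt_succ_of_le hik))
  have h2 := Set.mem_of_indicator_ne_zero h1
  rw [sub_neg_eq_add, sub_neg_eq_add, add_comm _ (p.origin u).2, add_comm _ (p.origin v).2]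
  exact h2

end Params

theorem infEDist_leafSegment_le {u v : E3} {ε ρ : ℝ} (hε : 0 < ε) (hρ : 0 < ρ)
    (h0 : |u 0 - v 0| ≤ ρ) (h1 : |v 1 - u 1| ≤ 2 * ε) (h2 : |u 2 - v 2| ≤ ρ) :
    Metric.infEDist v (leafSegment u ε) ≤ ENNReal.ofReal (3 * ρ) := by
  -- The leaf segment is open while `h1` allows equality, so the second coordinate is moved slightly
  -- towards `u 1`.
  obtain ⟨κ, hκ0, hκ1, hκ2⟩ : ∃ κ : ℝ, 0 < κ ∧ κ ≤ 1 ∧ κ * (2 * ε) ≤ ρ := by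
    refine ⟨min 1 (ρ / (2 * ε)), by positivity, min_le_left _ _, ?_⟩
    rw [← le_div_iff₀ (by positivity)]
    exact min_le_right _ _
  have hw : !₂[u 0, v 1 - κ * (v 1 - u 1), u 2] ∈ leafSegment u ε := by
    refine ⟨rfl, rfl, ?_⟩
    have e : v 1 - κ * (v 1 - u 1) - u 1 = (1 - κ) * (v 1 - u 1) := by ring
    simp only [Matrix.cons_val_one, Matrix.cons_val_zero, e, abs_mul,
      abs_of_nonneg (sub_nonneg.2 hκ1)]
    nlinarith [abs_nonneg (v 1 - u 1)]
  refine (Metric.infEDist_le_edist_of_mem hw).trans ?_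
  rw [edist_dist]
  apply ENNReal.ofReal_le_ofReal
  rw [EuclideanSpace.dist_eq]
  apply Real.sqrt_le_iff.2 ⟨by positivity, ?_⟩
  rw [Fin.sum_univ_three]
  simp only [Real.dist_eq, Matrix.cons_val_zero, Matrix.cons_val_one, Matrix.cons_val]
  rw [abs_sub_comm] at h0 h2
  have g1 : |v 1 - (v 1 - κ * (v 1 - u 1))| ≤ ρ := by
    rw [sub_sub_cancel, abs_mul, abs_of_pos hκ0]
    exact (mul_le_mul_of_nonneg_left h1 hκ0.le).trans hκ2
  have g0 := pow_le_pow_left₀ (abs_nonneg _) h0 2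
  have g1 := pow_le_pow_left₀ (abs_nonneg _) g1 2
  have g2 := pow_le_pow_left₀ (abs_nonneg _) h2 2
  nlinarith [sq_nonneg ρ]

end GeoLorenz

/-! ### Conclusion -/

theorem mainTheorem3 (p : GeoLorenz.Params) (hp : p.Admissible) :
    ∃ hmax : ℝ, 0 < hmax ∧ ∃ εmax : ℝ, 0 < εmax ∧
      ∀ q : GeoLorenz.E3 → ℝ, p.IsPrior q →
      ∀ ε : ℝ, 0 < ε → ε ≤ εmax → ∀ h : ℝ, 0 < h → h ≤ hmax →
      ∀ᵐ u ∂(volume : Measure GeoLorenz.E3), u ∈ p.stateSpace →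
        ∀ (Ω : Type*) [MeasurableSpace Ω] (P : Measure Ω) [IsProbabilityMeasure P]
          (Z : ℕ → Ω → GeoLorenz.E3),
          (∀ i, Measurable (Z i)) → iIndepFun Z P →
          (∀ i, pdf.IsUniform (Z i) (GeoLorenz.noiseCube ε) P volume) →
          ∀ᵐ ω ∂P, Tendsto
            (fun k : ℕ =>
              ⨆ v ∈ p.smootherSupport h ε q k (fun i => p.flow (i * h) u + Z i ω),
                Metric.infEDist v (GeoLorenz.leafSegment u ε))
            atTop (𝓝 0) := by
  obtain ⟨D, hmax, εmax, h1, h2, hsmall⟩ := hp.exists_small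
  refine ⟨hmax, h1, εmax, h2, fun q _ ε hε hε' h hh hh' => ?_⟩
  have hs := hsmall h ε hh hh' hε hε'
  -- On these planes lie the points with `t = 0` (third coordinate `1`) and with `t = p.timeToSigma
  -- a` (first coordinate `±1`).
  have hplane : ∀ (j : Fin 3) (c : ℝ), ∀ᵐ u ∂(volume : Measure GeoLorenz.E3), u j ≠ c :=
    fun j c => compl_mem_ae_iff.2
      (GeoLorenz.volume_coord_mem_countable j (Set.countable_singleton c))
  filter_upwards [hp.ae_iterate_ne_zero, hplane 0 1, hplane 0 (-1), hplane 2 1]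
    with u hu u1 u2 u3 hmem Ω _ P _ Z hZm hZi hZu
  have hO := GeoLorenz.Params.isOrigin_origin hmem
  have h0 := hu _ _ hO
  obtain ⟨ha, hat, hau⟩ := hO
  set a := (p.origin u).1
  set t := (p.origin u).2
  have a0 : a 0 ≠ 0 := h0 0
  have ht : 0 < t := by
    refine lt_of_le_of_ne hat.1 fun h => u3 ?_
    rw [← hau, ← h, hs.excursion_short hp ha (by linarith [hs.D_pos]),
      GeoLorenz.Params.linFlow_two, ha.2.2]
    simp
  have htT : t ≠ p.timeToSigma a := by
    intro h
    have e : u 0 = a 0 / |a 0| := by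
      rw [← hau, h, GeoLorenz.Params.excursion_eq_linFlow (Or.inr le_rfl)]
      exact (GeoLorenz.Params.exitPoint_bounds hp ha a0).1
    rcases lt_or_gt_of_ne a0 with hn | hn
    · rw [abs_of_neg hn, div_neg, div_self a0] at e
      exact u2 e
    · rw [abs_of_pos hn, div_self a0] at e
      exact u1 e
  have ha' := GeoLorenz.Params.returnMap_mem hp ha a0
  have h0' : ∀ i, p.returnMap^[i] (p.returnMap a) 0 ≠ 0 := fun i => by
    rw [← Function.iterate_succ_apply]
    exact h0 _
  have hE : ∀ᵐ ω ∂P, -2 ≤ -t →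
      GeoLorenz.Params.NoiseExtreme ε (fun i => Z i ω) (p.tick D h a (-t)) := by
    by_cases h2 : -2 ≤ -t
    · filter_upwards [GeoLorenz.ae_noiseExtreme hε hZm hZi hZu
        (hs.tick_injective hp ha h0 h2)] with ω hω _
      exact hω
    · exact Eventually.of_forall fun ω h => absurd h h2
  filter_upwards [GeoLorenz.ae_forall_mem_noiseCube hε hZu, hE,
    GeoLorenz.ae_noiseExtreme hε hZm hZi hZu (hs.tick_injective hp ha' h0'
      (ta := -t + p.returnTime a) (by linarith [hat.2 a0]))] with ω hZ hN hN'
  rw [ENNReal.tendsto_atTop_zero]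
  intro η hη
  obtain ⟨ρ, hρ, hρη⟩ : ∃ ρ : ℝ, 0 < ρ ∧ ENNReal.ofReal (3 * ρ) ≤ η := by
    rcases eq_or_ne η ⊤ with rfl | htop
    · exact ⟨1, one_pos, le_top⟩
    · refine ⟨η.toReal / 3, div_pos (ENNReal.toReal_pos hη.ne' htop) (by norm_num), ?_⟩
      rw [mul_div_cancel₀ _ (by norm_num), ENNReal.ofReal_toReal htop]
  obtain ⟨K₀, hK₀⟩ := hs.compatible_limit hp ha hat ht htT h0 hZ hN hN' hρ
  obtain ⟨k₀, hk₀⟩ := exists_nat_ge (K₀ / h)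
  rw [div_le_iff₀ hh] at hk₀
  refine ⟨k₀, fun k hk => iSup₂_le fun v hv => ?_⟩
  obtain ⟨hv1, hc⟩ := GeoLorenz.Params.compatible_of_mem_smootherSupport hv hh
  obtain ⟨hb, hbs, hbv⟩ := GeoLorenz.Params.isOrigin_origin hv1
  have hk' : (k₀ : ℝ) * h ≤ k * h := by gcongr
  obtain ⟨e0, e2⟩ := hK₀ (k * h) (hk₀.trans hk') _ hb _ hbs hc
  -- The second coordinate is controlled by the observation at time `0` alone and does not improve
  -- with `k`.
  have e1 := hc.close hZ 0 (by simpa using ht.le) (by simpa using hbs.1)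
    (by simp; positivity) 1
  simp only [CharP.cast_eq_zero, zero_mul, zero_sub, neg_neg] at e1
  rw [GeoLorenz.Params.orbit_of_lt (or_iff_not_imp_left.2 hat.2),
    GeoLorenz.Params.orbit_of_lt (or_iff_not_imp_left.2 hbs.2), hau, hbv, abs_sub_comm] at e1
  rw [hau, hbv] at e0 e2
  exact (GeoLorenz.infEDist_leafSegment_le hε hρ e0 e1 e2).trans hρη
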